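/- Let $k$ be a commutative ring (for instance $\mathbb Z$ or a field), and let $\widetilde{\mathcal P}$ be a symmetric operad in sets without operations of arity $0$. Assume that $\widetilde{\mathcal P}$ is basic-set, i.e. for all operations $\nu_1,\dots,\nu_n$ the map $\nu\mapsto\gamma(\nu;\nu_1,\dots,\nu_n)$ is injective, and that it has a homogeneous presentation $\widetilde{\mathcal P}\cong\mathcal T(E)/(R)$: it is the quotient of the free operad on an $\mathbb S$-module $E$ in sets by the operadic congruence generated by a set $R$ of pairs of elements of $\mathcal T(E)$ with the same number of vertices. Give $\widetilde{\mathcal P}$ the induced weight grading (number of generators, so that the generators have weight $1$), and let $\mathcal P=k\langle\widetilde{\mathcal P}\rangle$ be the associated weight-graded linear operad. For a non-empty finite set $I$, a $\widetilde{\mathcal P}$-partition of $I$ is a partition $\{I_1,\dots,I_r\}$ of $I$ into non-empty blocks together with elements $B_j\in\widetilde{\mathcal P}(I_j)$. Put $\{B_j\}\le\{C_m\}$ if each $C_m$ can be written $\gamma(\nu_m;B_{p_1},\dots,B_{p_s})$ for some operation $\nu_m$, where the blocks underlying $B_{p_1},\dots,B_{p_s}$ partition the block underlying $C_m$. For $d\in\mathbb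 N$ let $\Pi^{(d)}(I)$ be the poset of the $\widetilde{\mathcal P}$-partitions of $I$ that are $\le\{\nu\}$ for some $\nu\in\widetilde{\mathcal P}(I)$ of weight $d$. Let $\Delta_l(\Pi^{(d)}(I))$ be the set of chains $\lambda_0<\lambda_1<\dots<\lambda_l$ in $\Pi^{(d)}(I)$ with $\lambda_0$ minimal and $\lambda_l$ maximal. On the free modules $k[\Delta_l(\Pi^{(d)}(I))]$, for $l\ge1$, the face $d_i$ omits $\lambda_i$ if $0<i<l$, and $d_0=d_l=0$. Let $\mathcal N_l(\mathcal P)^{(d)}(I)$ be the submodule of the $l$-fold composite product $(\mathcal P\circ\cdots\circ\mathcal P)(I)$ (for $l=0$, the unit $\mathbb S$-module) spanned by the non-degenerate $l$-levelled trees with set of leaves $I$, whose vertices are labelled by homogeneous elements of $\mathcal P$ of total weight $d$; non-degenerate means that every level contains a label of positive weight, equivalently (since $\mathcal P^{(0)}$ is spanned by the identity) that the labels of no level are all multiples of the identity. For $l\ge1$, the face $d_i$ composes the $i$-th and $(i+1)$-st levels, counted from the leaves, if $0<i<l$, and $d_0=d_l=0$ (these two faces are given by the augmentation of $\mathcal P$,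 which vanishes in positive weight). Then, for every $d\in\mathbb N$, the order complex $k[\Delta_*(\Pi^{(d)})]$ and the weight $d$ part $\mathcal N_*(\mathcal P)^{(d)}$ of the normalised bar construction are presimplicial $\mathbb S$-modules (functors on non-empty finite sets and bijections, with equivariant faces satisfying $d_id_j=d_{j-1}d_i$ for $i<j$), and they are isomorphic as presimplicial $\mathbb S$-modules: there are $k$-linear isomorphisms $k[\Delta_l(\Pi^{(d)}(I))]\cong\mathcal N_l(\mathcal P)^{(d)}(I)$, for all $l$ and $I$, that commute with the actions of bijections and with all faces. -/

import Mathlib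

open scoped DirectSum TensorProduct

universe u v w

noncomputable section

namespace OperadPoset

/-! ### Maps of finite sets and their fibres -/

/-- The fibre of `f` over `j`. -/
abbrev Fib {I J : Type} (f : I → J) (j : J) : Type := {i : I // f i = j}

/-- The map induced by `f` from the fibre of `h = g ∘ f` over `k` to the fibre of `g` over `k`. -/
def fibMap {I J K : Type} (f : I → J) (g : J → K) (h : I → K) (hc : ∀ i, g (f i) = h i) (k : K)
    (i : Fib h k) : Fib g k :=
  ⟨f i.1, (hc i.1).trans i.2⟩

/-- A fibre of `f` is a fibre of the induced map between the fibres of `h = g ∘ f` and `g`. -/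
def fibFib {I J K : Type} (f : I → J) (g : J → K) (h : I → K) (hc : ∀ i, g (f i) = h i) (k : K)
    (j : Fib g k) : Fib f j.1 ≃ Fib (fibMap f g h hc k) j where
  toFun i := ⟨⟨i.1, by rw [← hc, i.2, j.2]⟩, Subtype.ext i.2⟩
  invFun i := ⟨i.1.1, congrArg Subtype.val i.2⟩
  left_inv _ := rfl
  right_inv _ := rfl

/-- A commutative square with vertical bijections induces bijections between fibres. -/
def fibSquare {I J I' J' : Type} (e : I ≃ I') (h : J ≃ J') (f : I → J) (f' : I' → J')
    (w : ∀ i, f' (e i) = h (f i)) (j' : J') : Fib f (h.symm j') ≃ Fib f' j' :=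
  e.subtypeEquiv fun i => by rw [w, Equiv.eq_symm_apply]

/-- The unique fibre of a map to a point. -/
def fibUnit {I : Type} (f : I → Unit) : Fib f () ≃ I where
  toFun i := i.1
  invFun i := ⟨i, rfl⟩
  left_inv _ := rfl
  right_inv _ := rfl

/-- The fibres of the identity are points. -/
def unitFib {I : Type} (i : I) : Unit ≃ Fib (fun x : I => x) i where
  toFun _ := ⟨i, rfl⟩
  invFun _ := ()
  left_inv _ := rfl
  right_inv x := Subtype.ext x.2.symm

/-! ### `𝕊`-modules and operads in sets -/

/-- An `𝕊`-module in sets, as a functor on finite sets and bijections. The set of operations of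
arity `n` is the value at `Fin n`. -/
structure SMod where
  obj : (I : Type) → [Finite I] → Type u
  map : {I J : Type} → [Finite I] → [Finite J] → (I ≃ J) → obj I → obj J
  map_refl : ∀ {I : Type} [Finite I] (x : obj I), map (Equiv.refl I) x = x
  map_trans : ∀ {I J K : Type} [Finite I] [Finite J] [Finite K] (e : I ≃ J) (e' : J ≃ K)
    (x : obj I), map (e.trans e') x = map e' (map e x)

/-- The operations of a set operad, without the axioms. For `f : I → J`, an operation with inputs
`J` can be composed with a family of operations whose inputs are the fibres of `f`; the result has
inputs `I`. -/
structure PreOperad where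
  obj : (I : Type) → [Finite I] → Type u
  map : {I J : Type} → [Finite I] → [Finite J] → (I ≃ J) → obj I → obj J
  one : obj Unit
  comp : {I J : Type} → [Finite I] → [Finite J] → (f : I → J) → obj J →
    (∀ j, obj (Fib f j)) → obj I

namespace PreOperad

variable (P : PreOperad.{u})

/-- A family of operations whose inputs are the fibres of `f`. -/
abbrev Fam {I J : Type} [Finite I] (f : I → J) : Type u := ∀ j, P.obj (Fib f j)

/-- Transport of a family of operations along a commutative square with vertical bijections. -/
def famMap {I J I' J' : Type} [Finite I] [Finite I'] (e : I ≃ I') (h : J ≃ J') (f : I → J)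
    (f' : I' → J') (w : ∀ i, f' (e i) = h (f i)) (q : P.Fam f) : P.Fam f' :=
  fun j' => P.map (fibSquare e h f f' w j') (q (h.symm j'))

/-- Composition of a family of operations over `g` with a family over `f`, giving a family over
`h = g ∘ f`. -/
def famComp {I J K : Type} [Finite I] [Finite J] (f : I → J) (g : J → K) (h : I → K)
    (hc : ∀ i, g (f i) = h i) (q : P.Fam g) (r : P.Fam f) : P.Fam h :=
  fun k => P.comp (fibMap f g h hc k) (q k) fun j => P.map (fibFib f g h hc k j) (r j.1)

/-- The family of identity operations over the identity map. -/
def famOne (I : Type) [Finite I] : P.Fam (fun x : I => x) := fun i => P.map (unitFib i) P.one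

end PreOperad

/-- A symmetric operad in sets. -/
structure SetOperad extends PreOperad.{u} where
  map_refl : ∀ {I : Type} [Finite I] (x : obj I), map (Equiv.refl I) x = x
  map_trans : ∀ {I J K : Type} [Finite I] [Finite J] [Finite K] (e : I ≃ J) (e' : J ≃ K)
    (x : obj I), map (e.trans e') x = map e' (map e x)
  comp_map : ∀ {I J I' J' : Type} [Finite I] [Finite J] [Finite I'] [Finite J'] (e : I ≃ I')
    (h : J ≃ J') (f : I → J) (f' : I' → J') (w : ∀ i, f' (e i) = h (f i)) (p : obj J)
    (q : toPreOperad.Fam f),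
    comp f' (map h p) (toPreOperad.famMap e h f f' w q) = map e (comp f p q)
  one_comp : ∀ {I : Type} [Finite I] (f : I → Unit) (q : toPreOperad.Fam f),
    comp f one q = map (fibUnit f) (q ())
  comp_one : ∀ {I : Type} [Finite I] (p : obj I),
    comp (fun x => x) p (toPreOperad.famOne I) = p
  comp_assoc : ∀ {I J K : Type} [Finite I] [Finite J] [Finite K] (f : I → J) (g : J → K)
    (p : obj K) (q : toPreOperad.Fam g) (r : toPreOperad.Fam f),
    comp f (comp g p q) r =
      comp (fun i => g (f i)) p (toPreOperad.famComp f g _ (fun _ => rfl) q r)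

/-- An isomorphism of set operads. -/
structure OperadIso (P : SetOperad.{u}) (Q : SetOperad.{v}) where
  toEquiv : (I : Type) → [Finite I] → P.obj I ≃ Q.obj I
  map_map : ∀ {I J : Type} [Finite I] [Finite J] (e : I ≃ J) (x : P.obj I),
    toEquiv J (P.map e x) = Q.map e (toEquiv I x)
  map_one : toEquiv Unit P.one = Q.one
  map_comp : ∀ {I J : Type} [Finite I] [Finite J] (f : I → J) (p : P.obj J)
    (q : P.toPreOperad.Fam f),
    toEquiv I (P.comp f p q) = Q.comp f (toEquiv J p) fun j => toEquiv _ (q j)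

/-- An operad is basic-set when all the maps `p ↦ γ(p; q₁, …, qₙ)` are injective. -/
def SetOperad.IsBasicSet (P : SetOperad.{u}) : Prop :=
  ∀ {I J : Type} [Finite I] [Finite J] (f : I → J) (q : P.toPreOperad.Fam f),
    Function.Injective fun p : P.obj J => P.comp f p q

/-! ### Quotients, free operads and presentations -/

/-- The smallest congruence containing `R` modulo which the operad axioms hold. When `A` is already
an operad, this is the operadic congruence generated by `R`. -/
inductive OperadCongr (A : PreOperad.{u})
    (R : (I : Type) → [Finite I] → A.obj I → A.obj I → Prop) :
    {I : Type} → [Finite I] → A.obj I → A.obj I → Prop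
  | of {I : Type} [Finite I] {x y : A.obj I} (h : R I x y) : OperadCongr A R x y
  | refl {I : Type} [Finite I] (x : A.obj I) : OperadCongr A R x x
  | symm {I : Type} [Finite I] {x y : A.obj I} (h : OperadCongr A R x y) : OperadCongr A R y x
  | trans {I : Type} [Finite I] {x y z : A.obj I} (h : OperadCongr A R x y)
      (h' : OperadCongr A R y z) : OperadCongr A R x z
  | map {I J : Type} [Finite I] [Finite J] (e : I ≃ J) {x y : A.obj I}
      (h : OperadCongr A R x y) : OperadCongr A R (A.map e x) (A.map e y)
  | comp {I J : Type} [Finite I] [Finite J] (f : I → J) {p p' : A.obj J} {q q' : A.Fam f}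
      (h : OperadCongr A R p p') (h' : ∀ j, OperadCongr A R (q j) (q' j)) :
      OperadCongr A R (A.comp f p q) (A.comp f p' q')
  | map_refl {I : Type} [Finite I] (x : A.obj I) : OperadCongr A R (A.map (Equiv.refl I) x) x
  | map_trans {I J K : Type} [Finite I] [Finite J] [Finite K] (e : I ≃ J) (e' : J ≃ K)
      (x : A.obj I) : OperadCongr A R (A.map (e.trans e') x) (A.map e' (A.map e x))
  | comp_map {I J I' J' : Type} [Finite I] [Finite J] [Finite I'] [Finite J'] (e : I ≃ I')
      (h : J ≃ J') (f : I → J) (f' : I' → J') (w : ∀ i, f' (e i) = h (f i)) (p : A.obj J)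
      (q : A.Fam f) :
      OperadCongr A R (A.comp f' (A.map h p) (A.famMap e h f f' w q)) (A.map e (A.comp f p q))
  | one_comp {I : Type} [Finite I] (f : I → Unit) (q : A.Fam f) :
      OperadCongr A R (A.comp f A.one q) (A.map (fibUnit f) (q ()))
  | comp_one {I : Type} [Finite I] (p : A.obj I) :
      OperadCongr A R (A.comp (fun x => x) p (A.famOne I)) p
  | comp_assoc {I J K : Type} [Finite I] [Finite J] [Finite K] (f : I → J) (g : J → K)
      (p : A.obj K) (q : A.Fam g) (r : A.Fam f) :
      OperadCongr A R (A.comp f (A.comp g p q) r)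
        (A.comp (fun i => g (f i)) p (A.famComp f g _ (fun _ => rfl) q r))

/-- The congruence `OperadCongr A R` as a setoid. -/
def operadSetoid (A : PreOperad.{u}) (R : (I : Type) → [Finite I] → A.obj I → A.obj I → Prop)
    (I : Type) [Finite I] : Setoid (A.obj I) where
  r := OperadCongr A R
  iseqv := ⟨.refl, .symm, .trans⟩

/-- The operations on the quotient by `OperadCongr A R`. -/
def preQuot (A : PreOperad.{u}) (R : (I : Type) → [Finite I] → A.obj I → A.obj I → Prop) :
    PreOperad.{u} where
  obj I _ := Quotient (operadSetoid A R I)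
  map e := Quotient.map (A.map e) fun _ _ h => OperadCongr.map e h
  one := Quotient.mk _ A.one
  comp f p q := Quotient.mk _ (A.comp f p.out fun j => (q j).out)

theorem preQuot_comp_mk (A : PreOperad.{u})
    (R : (I : Type) → [Finite I] → A.obj I → A.obj I → Prop) {I J : Type} [Finite I] [Finite J]
    (f : I → J) (p : A.obj J) (q : A.Fam f) :
    (preQuot A R).comp f (Quotient.mk (operadSetoid A R J) p)
        (fun j => Quotient.mk (operadSetoid A R _) (q j)) =
      Quotient.mk (operadSetoid A R I) (A.comp f p q) :=
  Quotient.sound (OperadCongr.comp f (Quotient.mk_out (s := operadSetoid A R _) p)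
    fun j => Quotient.mk_out (s := operadSetoid A R _) (q j))

theorem preQuot_fam (A : PreOperad.{u})
    (R : (I : Type) → [Finite I] → A.obj I → A.obj I → Prop) {I J : Type} [Finite I]
    {f : I → J} (q : (preQuot A R).Fam f) :
    ∃ q' : A.Fam f, q = fun j => Quotient.mk (operadSetoid A R _) (q' j) :=
  ⟨fun j => (q j).out, funext fun j => (Quotient.out_eq (q j)).symm⟩

/-- The operad generated by the operations `A` subject to the relations `R` and to the operad
axioms. When `A` is an operad this is the quotient `A/(R)`. -/
def quotOperad (A : PreOperad.{u}) (R : (I : Type) → [Finite I] → A.obj I → A.obj I → Prop) :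
    SetOperad.{u} where
  toPreOperad := preQuot A R
  map_refl x := Quotient.inductionOn x fun x => Quotient.sound (.map_refl x)
  map_trans e e' x := Quotient.inductionOn x fun x => Quotient.sound (.map_trans e e' x)
  comp_map e h f f' w p q := by
    obtain ⟨q, rfl⟩ := preQuot_fam A R q
    refine Quotient.inductionOn p fun p => ?_
    rw [preQuot_comp_mk]
    exact (preQuot_comp_mk A R f' (A.map h p) (A.famMap e h f f' w q)).trans
      (Quotient.sound (.comp_map e h f f' w p q))
  one_comp f q := by
    obtain ⟨q, rfl⟩ := preQuot_fam A R q
    exact (preQuot_comp_mk A R f A.one q).trans (Quotient.sound (.one_comp f q))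
  comp_one p := by
    refine Quotient.inductionOn p fun p => ?_
    exact (preQuot_comp_mk A R _ p (A.famOne _)).trans (Quotient.sound (.comp_one p))
  comp_assoc f g p q r := by
    obtain ⟨q, rfl⟩ := preQuot_fam A R q
    obtain ⟨r, rfl⟩ := preQuot_fam A R r
    refine Quotient.inductionOn p fun p => ?_
    rw [preQuot_comp_mk, preQuot_comp_mk]
    refine (Quotient.sound (OperadCongr.comp_assoc (R := R) f g p q r)).trans ?_
    rw [← preQuot_comp_mk]
    congr 1
    funext k
    exact (preQuot_comp_mk A R (fibMap f g _ (fun _ => rfl) k) (q k)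
      fun j => A.map (fibFib f g _ (fun _ => rfl) k j) (r j.1)).symm

/-- Formal operadic composites of elements of `E`. -/
inductive Term (E : SMod.{u}) : Type → Type (max 1 u)
  | one : Term E Unit
  | gen {I : Type} [Finite I] (x : E.obj I) : Term E I
  | map {I J : Type} [Finite I] [Finite J] (e : I ≃ J) (t : Term E I) : Term E J
  | comp {I J : Type} [Finite I] [Finite J] (f : I → J) (p : Term E J)
      (q : ∀ j, Term E (Fib f j)) : Term E I

/-- The formal composites, with their formal operations. -/
def termOperad (E : SMod.{u}) : PreOperad.{max 1 u} where
  obj I _ := Term E I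
  map := Term.map
  one := Term.one
  comp := Term.comp

/-- The relations making the inclusion of generators equivariant. -/
inductive GenRel (E : SMod.{u}) : (I : Type) → [Finite I] → Term E I → Term E I → Prop
  | mk {I J : Type} [Finite I] [Finite J] (e : I ≃ J) (x : E.obj I) :
      GenRel E J (Term.gen (E.map e x)) (Term.map e (Term.gen x))

/-- The free operad `𝒯(E)`. -/
def free (E : SMod.{u}) : SetOperad.{max 1 u} := quotOperad (termOperad E) (GenRel E)

/-- A weight on operations: the unit has weight `0` and weights add up under composition. -/
structure Weighting (P : PreOperad.{u}) where
  wt : {I : Type} → [Finite I] → P.obj I → ℕ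
  wt_one : wt P.one = 0
  wt_map : ∀ {I J : Type} [Finite I] [Finite J] (e : I ≃ J) (x : P.obj I), wt (P.map e x) = wt x
  wt_comp : ∀ {I J : Type} [Finite I] [Finite J] (f : I → J) (p : P.obj J) (q : P.Fam f),
    wt (P.comp f p q) = wt p + ∑ᶠ j, wt (q j)

theorem Weighting.congr {A : PreOperad.{u}} (W : Weighting A)
    {R : (I : Type) → [Finite I] → A.obj I → A.obj I → Prop}
    (hR : ∀ (I : Type) [Finite I] (x y : A.obj I), R I x y → W.wt x = W.wt y)
    {I : Type} [Finite I] {x y : A.obj I} (h : OperadCongr A R x y) : W.wt x = W.wt y := by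
  induction h with
  | of h => exact hR _ _ _ h
  | refl x => rfl
  | symm _ ih => exact ih.symm
  | trans _ _ ih ih' => exact ih.trans ih'
  | map e _ ih => simpa [W.wt_map] using ih
  | comp f _ _ ih ih' => rw [W.wt_comp, W.wt_comp, ih, finsum_congr ih']
  | map_refl x => simp [W.wt_map]
  | map_trans e e' x => simp [W.wt_map]
  | comp_map e h f f' w p q =>
    simp only [W.wt_map, W.wt_comp, PreOperad.famMap]
    rw [← finsum_comp_equiv h.symm]
  | one_comp f q =>
    simp [W.wt_map, W.wt_comp, W.wt_one, finsum_eq_sum_of_fintype]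
  | comp_one p => simp [W.wt_map, W.wt_comp, W.wt_one, PreOperad.famOne]
  | @comp_assoc I J K _ _ _ f g p q r =>
    have := Fintype.ofFinite J
    have := Fintype.ofFinite K
    have hs : ∀ k, Fintype (Fib g k) := fun k => Fintype.ofFinite _
    simp only [W.wt_map, W.wt_comp, PreOperad.famComp, finsum_eq_sum_of_fintype]
    rw [Finset.sum_add_distrib, add_assoc]
    congr 2
    rw [← Fintype.sum_sigma' fun k (j : Fib g k) => W.wt (r j.1)]
    exact (Fintype.sum_equiv (Equiv.sigmaFiberEquiv g) _ _ fun _ => rfl).symm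

/-- A weight preserved by the relations induces a weight on the quotient. -/
def Weighting.quot {A : PreOperad.{u}} (W : Weighting A)
    {R : (I : Type) → [Finite I] → A.obj I → A.obj I → Prop}
    (hR : ∀ (I : Type) [Finite I] (x y : A.obj I), R I x y → W.wt x = W.wt y) :
    Weighting (quotOperad A R).toPreOperad where
  wt := Quotient.lift W.wt fun _ _ h => W.congr hR h
  wt_one := W.wt_one
  wt_map e x := Quotient.inductionOn x fun x => W.wt_map e x
  wt_comp f p q := by
    obtain ⟨q, rfl⟩ := preQuot_fam A R q
    refine Quotient.inductionOn p fun p => ?_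
    exact (congrArg (Quotient.lift W.wt fun _ _ h => W.congr hR h)
      (preQuot_comp_mk A R f p q)).trans (W.wt_comp f p q)

/-- The number of generators in a formal composite. -/
def Term.wt {E : SMod.{u}} : {I : Type} → Term E I → ℕ
  | _, .one => 0
  | _, @Term.gen _ _ _ _ => 1
  | _, @Term.map _ _ _ _ _ _ t => t.wt
  | _, @Term.comp _ _ _ _ _ _ p q => p.wt + ∑ᶠ j, (q j).wt

/-- The number of generators, as a weight. -/
def termWeighting (E : SMod.{u}) : Weighting (termOperad E) where
  wt t := Term.wt t
  wt_one := by simp [termOperad, Term.wt]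
  wt_map _ _ := by simp [termOperad, Term.wt]
  wt_comp _ _ _ := by simp [termOperad, Term.wt]

/-- The weight grading of the free operad: the number of vertices of a tree. -/
def freeWeighting (E : SMod.{u}) : Weighting (free E).toPreOperad :=
  (termWeighting E).quot fun _ _ _ _ h => by
    cases h
    simp [termWeighting, Term.wt]

/-- A homogeneous presentation `P ≅ 𝒯(E)/(R)` of a set operad: the two sides of every relation in
`R` have the same number of generators. -/
structure HomogeneousPresentation (P : SetOperad.{u}) where
  E : SMod.{v}
  R : (I : Type) → [Finite I] → (free E).obj I → (free E).obj I → Prop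
  homogeneous : ∀ (I : Type) [Finite I] (x y : (free E).obj I), R I x y →
    (freeWeighting E).wt x = (freeWeighting E).wt y
  iso : OperadIso P (quotOperad (free E).toPreOperad R)

/-- The weight grading of a presented operad, for which the generators have weight `1`. -/
def HomogeneousPresentation.weighting {P : SetOperad.{u}} (H : HomogeneousPresentation.{u, v} P) :
    Weighting P.toPreOperad where
  wt {I} _ x := ((freeWeighting H.E).quot H.homogeneous).wt (H.iso.toEquiv I x)
  wt_one := by rw [H.iso.map_one, Weighting.wt_one]
  wt_map e x := by rw [H.iso.map_map, Weighting.wt_map]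
  wt_comp f p q := by rw [H.iso.map_comp, Weighting.wt_comp]

/-! ### Composition of families of operations -/

namespace SetOperad

variable (P : SetOperad.{u})

theorem map_map {I J K : Type} [Finite I] [Finite J] [Finite K] (e : I ≃ J) (e' : J ≃ K)
    (x : P.obj I) : P.map e' (P.map e x) = P.map (e.trans e') x :=
  (P.map_trans e e' x).symm

theorem map_inj {I J : Type} [Finite I] [Finite J] (e : I ≃ J) :
    Function.Injective (P.map e) := fun x y h => by
  have := congrArg (P.map e.symm) h
  simpa [map_map, P.map_refl] using this

theorem map_fam {I J K : Type} [Finite I] [Finite K] {f : I → J} (q : P.Fam f) {j j' : J}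
    (h : j = j') (e : Fib f j ≃ K) (e' : Fib f j' ≃ K) (he : ∀ i hi hi', e ⟨i, hi⟩ = e' ⟨i, hi'⟩) :
    P.map e (q j) = P.map e' (q j') := by
  subst h
  congr 1
  ext ⟨i, hi⟩
  exact he i hi hi

theorem comp_unit {I J : Type} [Finite I] [Finite J] (f : I → J) (e : Unit ≃ J)
    (q : P.Fam f) (e' : Fib f (e ()) ≃ I) (he' : ∀ i, e' i = i.1) :
    P.comp f (P.map e P.one) q = P.map e' (q (e ())) := by
  have hq : q = P.famMap (Equiv.refl I) e (fun _ => ()) f (fun i => e.symm.injective (by simp))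
      (fun _ => P.map ((e'.trans (fibUnit (fun _ : I => ())).symm)) (q (e ()))) := by
    funext j
    have hj : j = e () := e.symm.injective (by simp)
    subst hj
    simp only [PreOperad.famMap, map_map]
    refine (P.map_refl _).symm.trans (congrArg (fun t => P.map t _) ?_)
    ext i
    simp [fibSquare, fibUnit, he']
  conv_lhs => rw [hq]
  rw [P.comp_map, P.map_refl, P.one_comp, map_map]
  rfl

theorem famComp_famMap {I J K I' J' K' : Type} [Finite I] [Finite J] [Finite I'] [Finite J']
    (eI : I ≃ I') (eJ : J ≃ J') (eK : K ≃ K')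
    (f : I → J) (g : J → K) (h : I → K) (hc : ∀ i, g (f i) = h i)
    (f' : I' → J') (g' : J' → K') (h' : I' → K') (hc' : ∀ i, g' (f' i) = h' i)
    (wf : ∀ i, f' (eI i) = eJ (f i)) (wg : ∀ j, g' (eJ j) = eK (g j))
    (wh : ∀ i, h' (eI i) = eK (h i)) (q : P.Fam g) (r : P.Fam f) :
    P.famComp f' g' h' hc' (P.famMap eJ eK g g' wg q) (P.famMap eI eJ f f' wf r) =
      P.famMap eI eK h h' wh (P.famComp f g h hc q r) := by
  funext k'
  simp only [PreOperad.famComp, PreOperad.famMap]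
  rw [← P.comp_map (fibSquare eI eK h h' wh k') (fibSquare eJ eK g g' wg k')
    (fibMap f g h hc (eK.symm k')) (fibMap f' g' h' hc' k')
    (fun i => Subtype.ext (wf i.1))]
  congr 1
  funext j'
  simp only [PreOperad.famMap, map_map]
  rfl

theorem famComp_assoc {A B C D : Type} [Finite A] [Finite B] [Finite C]
    (f : A → B) (g : B → C) (h : C → D) (gf : A → C) (hg : B → D) (hgf : A → D)
    (h₁ : ∀ a, g (f a) = gf a) (h₂ : ∀ b, h (g b) = hg b) (h₃ : ∀ a, hg (f a) = hgf a)
    (h₄ : ∀ a, h (gf a) = hgf a) (p : P.Fam h) (q : P.Fam g) (r : P.Fam f) :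
    P.famComp f hg hgf h₃ (P.famComp g h hg h₂ p q) r =
      P.famComp gf h hgf h₄ p (P.famComp f g gf h₁ q r) := by
  obtain rfl : (fun a => g (f a)) = gf := funext h₁
  funext d
  simp only [PreOperad.famComp]
  refine (P.comp_assoc _ _ _ _ _).trans
    (congrArg (P.comp (fibMap _ h hgf h₄ d) (p d)) (funext fun c => ?_))
  refine Eq.trans ?_ (P.comp_map (fibFib _ h hgf h₄ d c) (fibFib g h hg h₂ d c)
    (fibMap f g _ h₁ c.1)
    (fibMap (fibMap f hg hgf h₃ d) (fibMap g h hg h₂ d) _ (fun _ => rfl) c) (fun _ => rfl) _ _)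
  simp only [PreOperad.famComp]
  congr 1
  funext b
  simp only [PreOperad.famMap, map_map]
  rfl

end SetOperad

/-! ### Partitions with blocks decorated by operations -/

/-- The map between quotients induced by an inclusion of equivalence relations. -/
def qmap {I : Type} {σ τ : Setoid I} (h : σ ≤ τ) : Quotient σ → Quotient τ :=
  Quotient.map id fun _ _ hab => h hab

/-- A bijection of sets induces a bijection between the blocks of a partition and those of its
image. -/
def quotEquiv {I I' : Type} (e : I ≃ I') (σ : Setoid I) :
    Quotient σ ≃ Quotient (σ.comap e.symm) :=
  Quotient.congr e fun a b => by
    change σ a b ↔ σ (e.symm (e a)) (e.symm (e b))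
    simp

theorem comap_le_comap {I I' : Type} (e : I ≃ I') {σ τ : Setoid I} (h : σ ≤ τ) :
    σ.comap e.symm ≤ τ.comap e.symm := fun _ _ hab => h hab

theorem qmap_quotEquiv {I I' : Type} (e : I ≃ I') {σ τ : Setoid I} (h : σ ≤ τ) (b : Quotient σ) :
    qmap (comap_le_comap e h) (quotEquiv e σ b) = quotEquiv e τ (qmap h b) :=
  Quotient.inductionOn b fun _ => rfl

/-- A `P`-partition of `I`: a partition `{I₁, …, Iᵣ}` of `I` together with an element of `P(I_k)`
for every block. -/
@[ext]
structure PPart (P : SetOperad.{u}) (I : Type) [Finite I] where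
  part : Setoid I
  block : P.Fam (Quotient.mk part)

namespace PPart

variable {P : SetOperad.{u}} {I : Type} [Finite I]

/-- The order on `P`-partitions: `x ≤ y` when every block `C` of `y` is a composite `γ(ν; B₁, …, Bₛ)`
of blocks of `x`. -/
instance : LE (PPart P I) where
  le x y := ∃ (h : x.part ≤ y.part) (ν : P.Fam (qmap h)),
    y.block = P.famComp (Quotient.mk x.part) (qmap h) (Quotient.mk y.part) (fun _ => rfl) ν x.block

/-- The `P`-partition `ν̄` with a single block, for `ν ∈ P(I)`. -/
def single (ν : P.obj I) : PPart P I where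
  part := ⊤
  block c := P.map
    (Equiv.subtypeUnivEquiv fun _ => Quotient.inductionOn c fun _ => Quotient.sound trivial).symm ν

/-- The action of bijections on `P`-partitions. -/
def map {I' : Type} [Finite I'] (e : I ≃ I') (x : PPart P I) : PPart P I' where
  part := x.part.comap e.symm
  block := P.famMap e (quotEquiv e x.part) _ _ (fun _ => rfl) x.block

theorem le_refl (x : PPart P I) : x ≤ x := by
  have hq : ∀ b, qmap (_root_.le_refl x.part) b = b := fun b => Quotient.inductionOn b fun _ => rfl
  let e : ∀ b, Unit ≃ Fib (qmap (_root_.le_refl x.part)) b := fun b =>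
    ⟨fun _ => ⟨b, hq b⟩, fun _ => (), fun _ => rfl, fun c => Subtype.ext (by
      simpa [hq] using c.2.symm)⟩
  refine ⟨_root_.le_refl _, fun b => P.map (e b) P.one, ?_⟩
  funext b
  simp only [PreOperad.famComp]
  rw [P.comp_unit _ (e b) _ (Equiv.subtypeUnivEquiv fun a => Subtype.ext a.2) fun _ => rfl]
  rw [SetOperad.map_map]
  exact ((P.map_refl _).symm.trans (P.map_fam x.block rfl _ _ fun i hi hi' => rfl))

theorem le_trans {x y z : PPart P I} (h : x ≤ y) (h' : y ≤ z) : x ≤ z := by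
  obtain ⟨h, ν, hν⟩ := h
  obtain ⟨h', ν', hν'⟩ := h'
  refine ⟨_root_.le_trans h h', P.famComp (qmap h) (qmap h') (qmap (_root_.le_trans h h'))
    (fun b => Quotient.inductionOn b fun _ => rfl) ν' ν, ?_⟩
  rw [hν', hν]
  exact (P.famComp_assoc _ _ _ _ _ _ _ _ _ _ _ _ _).symm

theorem map_le {I' : Type} [Finite I'] (e : I ≃ I') {x y : PPart P I} (h : x ≤ y) :
    x.map e ≤ y.map e := by
  obtain ⟨h, ν, hν⟩ := h
  refine ⟨comap_le_comap e h, P.famMap (quotEquiv e _) (quotEquiv e _) _ _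
    (qmap_quotEquiv e h) ν, ?_⟩
  simp only [map]
  rw [hν]
  exact (P.famComp_famMap _ _ _ _ _ _ _ _ _ _ _ _ _ _ _ _).symm

theorem ext' {x y : PPart P I} (h : x.part = y.part)
    (h' : ∀ i, ∃ e : Fib (Quotient.mk x.part) (Quotient.mk _ i) ≃
      Fib (Quotient.mk y.part) (Quotient.mk _ i), (∀ a, (e a).1 = a.1) ∧
      P.map e (x.block (Quotient.mk _ i)) = y.block (Quotient.mk _ i)) : x = y := by
  obtain ⟨σ, B⟩ := x
  obtain ⟨τ, C⟩ := y
  obtain rfl : σ = τ := h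
  congr 1
  funext b
  induction b using Quotient.inductionOn with | _ i => ?_
  obtain ⟨e, he, hB⟩ := h' i
  refine Eq.trans ?_ hB
  refine (P.map_refl _).symm.trans (congrArg (fun t => P.map t _) ?_)
  ext a
  exact (he a).symm

theorem map_map {I' I'' : Type} [Finite I'] [Finite I''] (e : I ≃ I') (e' : I' ≃ I'')
    (x : PPart P I) : (x.map e).map e' = x.map (e.trans e') := by
  refine ext' rfl fun i => ⟨Equiv.refl _, fun _ => rfl, ?_⟩
  exact (P.map_refl _).trans (P.map_map _ _ _)

theorem map_refl (x : PPart P I) : x.map (Equiv.refl I) = x := by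
  refine ext' rfl fun i => ⟨Equiv.refl _, fun _ => rfl, ?_⟩
  exact (P.map_refl _).trans (P.map_refl _)

theorem map_single {I' : Type} [Finite I'] (e : I ≃ I') (ν : P.obj I) :
    (single ν).map e = single (P.map e ν) := by
  refine ext' rfl fun i => ⟨Equiv.refl _, fun _ => rfl, ?_⟩
  refine (P.map_refl _).trans ?_
  simp only [map, single, PreOperad.famMap, SetOperad.map_map]
  rfl

end PPart

/-! ### The partition posets of a presented operad -/

namespace HomogeneousPresentation

variable {P : SetOperad.{u}} (H : HomogeneousPresentation.{u, v} P)

theorem exists_unit_of_wt {Q : SetOperad.{v}} {E : SMod.{u}}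
    (F : {I : Type} → [Finite I] → Term E I → Q.obj I)
    (hone : F .one = Q.one)
    (hmap : ∀ {I J : Type} [Finite I] [Finite J] (e : I ≃ J) (t : Term E I),
      F (.map e t) = Q.map e (F t))
    (hcomp : ∀ {I J : Type} [Finite I] [Finite J] (f : I → J) (p : Term E J)
      (q : ∀ j, Term E (Fib f j)), F (.comp f p q) = Q.comp f (F p) fun j => F (q j))
    {I : Type} (t : Term E I) :
    ∀ [Finite I], t.wt = 0 → ∃ e : Unit ≃ I, F t = Q.map e Q.one := by
  induction t with
  | one => intro _ _; exact ⟨Equiv.refl _, by rw [hone, Q.map_refl]⟩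
  | gen x => intro _ ht; simp [Term.wt] at ht
  | map e t ih =>
    intro _ ht
    obtain ⟨e', he'⟩ := ih (by simpa [Term.wt] using ht)
    exact ⟨e'.trans e, by rw [hmap, he', Q.map_map]⟩
  | @comp I J _ _ f p q ihp ihq =>
    intro _ ht
    have := Fintype.ofFinite J
    simp only [Term.wt, finsum_eq_sum_of_fintype, Nat.add_eq_zero_iff,
      Finset.sum_eq_zero_iff, Finset.mem_univ, true_implies] at ht
    obtain ⟨e, he⟩ := ihp ht.1
    obtain ⟨e', he'⟩ := ihq (e ()) (ht.2 _)
    have hi : ∀ i, f i = e () := fun i => e.symm.injective (by simp)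
    refine ⟨e'.trans (Equiv.subtypeUnivEquiv hi), ?_⟩
    rw [hcomp, he, Q.comp_unit f e _ (Equiv.subtypeUnivEquiv hi) fun _ => rfl, he', Q.map_map]

/-- The only operations of weight `0` are the identities. -/
theorem eq_unit_of_wt {I : Type} [Finite I] (x : P.obj I) (hx : H.weighting.wt x = 0) :
    ∃ e : Unit ≃ I, x = P.map e P.one := by
  obtain ⟨y, hy⟩ : ∃ y, y = H.iso.toEquiv I x := ⟨_, rfl⟩
  induction y using Quotient.inductionOn with | _ y => ?_
  induction y using Quotient.inductionOn with | _ t => ?_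
  obtain ⟨e, he⟩ := exists_unit_of_wt (Q := quotOperad (free H.E).toPreOperad H.R)
    (fun {I} _ t => Quotient.mk (operadSetoid _ _ I) (Quotient.mk (operadSetoid _ _ I) t))
    rfl (fun _ _ => rfl) (fun f p q => by
      refine Eq.trans ?_ (preQuot_comp_mk (free H.E).toPreOperad H.R f _ _).symm
      exact congrArg _ (preQuot_comp_mk (termOperad H.E) (GenRel H.E) f p q).symm) t (by
      simp only [weighting] at hx
      rw [← hy] at hx
      exact hx)
  refine ⟨e, (H.iso.toEquiv I).injective ?_⟩
  rw [H.iso.map_map, H.iso.map_one, ← hy, he]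

theorem le_antisymm (H : HomogeneousPresentation.{u, v} P) {I : Type} [Finite I]
    {x y : PPart P I} (h : x ≤ y) (h' : y ≤ x) : x = y := by
  have key : ∀ {x y : PPart P I} (h : x.part ≤ y.part) (ν : P.Fam (qmap h)),
      y.block = P.famComp (Quotient.mk x.part) (qmap h) (Quotient.mk y.part) (fun _ => rfl) ν
        x.block →
      ∑ᶠ c, H.weighting.wt (y.block c) =
        ∑ᶠ c, H.weighting.wt (ν c) + ∑ᶠ b, H.weighting.wt (x.block b) := by
    intro x y h ν hν
    have := Fintype.ofFinite (Quotient x.part)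
    have := Fintype.ofFinite (Quotient y.part)
    have hs : ∀ c, Fintype (Fib (qmap h) c) := fun c => Fintype.ofFinite _
    rw [hν]
    simp only [PreOperad.famComp, H.weighting.wt_comp, H.weighting.wt_map,
      finsum_eq_sum_of_fintype, Finset.sum_add_distrib]
    congr 1
    rw [← Fintype.sum_sigma' fun c (b : Fib (qmap h) c) => H.weighting.wt (x.block b.1)]
    exact Fintype.sum_equiv (Equiv.sigmaFiberEquiv (qmap h)) _ _ fun _ => rfl
  obtain ⟨h, ν, hν⟩ := h
  obtain ⟨h', ν', hν'⟩ := h'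
  have h₁ := key h ν hν
  have h₂ := key h' ν' hν'
  have h₀ : ∑ᶠ c, H.weighting.wt (ν c) = 0 := by omega
  have := Fintype.ofFinite (Quotient y.part)
  simp only [finsum_eq_sum_of_fintype, Finset.sum_eq_zero_iff, Finset.mem_univ,
    true_implies] at h₀
  obtain ⟨σ, B⟩ := x
  obtain ⟨τ, C⟩ := y
  obtain rfl : σ = τ := _root_.le_antisymm h h'
  congr 1
  funext c
  obtain ⟨e, he⟩ := H.eq_unit_of_wt (ν c) (h₀ c)
  have hq : ∀ b, qmap h b = b := fun b => Quotient.inductionOn b fun _ => rfl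
  have hc : (e ()).1 = c := (hq _).symm.trans (e ()).2
  have hi : ∀ i : Fib (Quotient.mk σ) c,
      fibMap (Quotient.mk σ) (qmap h) (Quotient.mk σ) (fun _ => rfl) c i = e () := fun i =>
    e.symm.injective (by simp)
  refine Eq.symm ((congrFun hν c).trans ?_)
  simp only [PreOperad.famComp]
  rw [he, P.comp_unit _ e _ (Equiv.subtypeUnivEquiv hi) fun _ => rfl, SetOperad.map_map]
  exact (P.map_fam B hc _ (Equiv.refl _) fun i hi hi' => rfl).trans (P.map_refl _)

/-- The poset `Π^{(d)}(I)` of those `P`-partitions of `I` lying below some `ν̄` with `ν ∈ P(I)` of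
weight `d`. -/
def WeightPoset (d : ℕ) (I : Type) [Finite I] : Type u :=
  {x : PPart P I // ∃ ν : P.obj I, H.weighting.wt ν = d ∧ x ≤ PPart.single ν}

instance (d : ℕ) (I : Type) [Finite I] : PartialOrder (H.WeightPoset d I) where
  le x y := x.1 ≤ y.1
  le_refl x := PPart.le_refl x.1
  le_trans _ _ _ h h' := PPart.le_trans h h'
  le_antisymm _ _ h h' := Subtype.ext (H.le_antisymm h h')

/-- The action of bijections on `Π^{(d)}`. -/
def mapPoset (d : ℕ) {I J : Type} [Finite I] [Finite J] (e : I ≃ J) :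
    H.WeightPoset d I ≃o H.WeightPoset d J where
  toFun x := ⟨x.1.map e, by
    obtain ⟨ν, hν, hx⟩ := x.2
    exact ⟨P.map e ν, by rw [H.weighting.wt_map, hν], PPart.map_single e ν ▸ PPart.map_le e hx⟩⟩
  invFun x := ⟨x.1.map e.symm, by
    obtain ⟨ν, hν, hx⟩ := x.2
    exact ⟨P.map e.symm ν, by rw [H.weighting.wt_map, hν],
      PPart.map_single e.symm ν ▸ PPart.map_le e.symm hx⟩⟩
  left_inv x := Subtype.ext (by simp [PPart.map_map, PPart.map_refl])
  right_inv x := Subtype.ext (by simp [PPart.map_map, PPart.map_refl])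
  map_rel_iff' {x y} := by
    refine ⟨fun h => ?_, fun h => PPart.map_le e h⟩
    have h' : (x.1.map e).map e.symm ≤ (y.1.map e).map e.symm := PPart.map_le e.symm h
    rw [PPart.map_map, PPart.map_map, Equiv.self_trans_symm, PPart.map_refl, PPart.map_refl] at h'
    exact h'

/-- The set `Δ_l(Π^{(d)}(I))` of chains `x₀ < x₁ < ⋯ < x_l` in `Π^{(d)}(I)` starting at a minimal
element and ending at a maximal element. -/
structure Chain (d : ℕ) (I : Type) [Finite I] (l : ℕ) where
  elt : Fin (l + 1) → H.WeightPoset d I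
  strictMono : StrictMono elt
  isMin : IsMin (elt 0)
  isMax : IsMax (elt (Fin.last l))

/-- The action of bijections on chains. -/
def Chain.map {H : HomogeneousPresentation.{u, v} P} {d l : ℕ} {I J : Type} [Finite I]
    [Finite J] (e : I ≃ J) (c : H.Chain d I l) :
    H.Chain d J l where
  elt a := H.mapPoset d e (c.elt a)
  strictMono := (H.mapPoset d e).strictMono.comp c.strictMono
  isMin := ((H.mapPoset d e).isMin_apply).2 c.isMin
  isMax := ((H.mapPoset d e).isMax_apply).2 c.isMax

/-- The chain obtained by omitting the inner element `x_{i+1}`. -/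
def Chain.drop {H : HomogeneousPresentation.{u, v} P} {d l : ℕ} {I : Type} [Finite I]
    (c : H.Chain d I (l + 1)) (i : Fin l) :
    H.Chain d I l where
  elt a := c.elt (i.castSucc.succ.succAbove a)
  strictMono := c.strictMono.comp (Fin.strictMono_succAbove _)
  isMin := by rw [Fin.succAbove_ne_zero_zero (Fin.succ_ne_zero _)]; exact c.isMin
  isMax := by
    rw [Fin.succAbove_ne_last_last fun h => (Fin.castSucc_lt_last i).ne (Fin.succ_injective _ h)]
    exact c.isMax

end HomogeneousPresentation

/-! ### Presimplicial `𝕊`-modules -/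

/-- A sequence of families of `k`-modules indexed by the non-empty finite sets, with an action of
bijections and face maps. -/
structure PresimplicialData (k : Type u) [CommRing k] where
  obj : ℕ → (I : Type) → [Finite I] → [Nonempty I] → Type w
  [acg : ∀ (l : ℕ) (I : Type) [Finite I] [Nonempty I], AddCommGroup (obj l I)]
  [mod : ∀ (l : ℕ) (I : Type) [Finite I] [Nonempty I], Module k (obj l I)]
  act : (l : ℕ) → {I J : Type} → [Finite I] → [Nonempty I] → [Finite J] → [Nonempty J] →
    (I ≃ J) → obj l I →ₗ[k] obj l J
  face : (l : ℕ) → (I : Type) → [Finite I] → [Nonempty I] → Fin (l + 2) →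
    obj (l + 1) I →ₗ[k] obj l I

attribute [instance] PresimplicialData.acg PresimplicialData.mod

/-- The data form a presimplicial `𝕊`-module: functoriality of the action, equivariance of the
faces, and `dᵢ dⱼ = dⱼ₋₁ dᵢ` for `i < j`. -/
structure PresimplicialData.IsPresimplicialSModule {k : Type u} [CommRing k]
    (M : PresimplicialData.{u, w} k) : Prop where
  act_refl : ∀ (l : ℕ) (I : Type) [Finite I] [Nonempty I] (x : M.obj l I),
    M.act l (Equiv.refl I) x = x
  act_trans : ∀ (l : ℕ) {I J K : Type} [Finite I] [Nonempty I] [Finite J] [Nonempty J]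
    [Finite K] [Nonempty K] (e : I ≃ J) (e' : J ≃ K) (x : M.obj l I),
    M.act l (e.trans e') x = M.act l e' (M.act l e x)
  face_act : ∀ (l : ℕ) {I J : Type} [Finite I] [Nonempty I] [Finite J] [Nonempty J] (e : I ≃ J)
    (i : Fin (l + 2)) (x : M.obj (l + 1) I),
    M.face l J i (M.act (l + 1) e x) = M.act l e (M.face l I i x)
  face_face : ∀ (l : ℕ) (I : Type) [Finite I] [Nonempty I] (i j : Fin (l + 2)), i ≤ j →
    ∀ x : M.obj (l + 2) I,
      M.face l I i (M.face (l + 1) I j.succ x) = M.face l I j (M.face (l + 1) I i.castSucc x)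

/-- An isomorphism of presimplicial `𝕊`-modules. -/
structure PresimplicialIso {k : Type u} [CommRing k] (M : PresimplicialData.{u, v} k)
    (N : PresimplicialData.{u, w} k) where
  toEquiv : (l : ℕ) → (I : Type) → [Finite I] → [Nonempty I] → M.obj l I ≃ₗ[k] N.obj l I
  map_act : ∀ (l : ℕ) {I J : Type} [Finite I] [Nonempty I] [Finite J] [Nonempty J] (e : I ≃ J)
    (x : M.obj l I), toEquiv l J (M.act l e x) = N.act l e (toEquiv l I x)
  map_face : ∀ (l : ℕ) (I : Type) [Finite I] [Nonempty I] (i : Fin (l + 2))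
    (x : M.obj (l + 1) I), toEquiv l I (M.face l I i x) = N.face l I i (toEquiv (l + 1) I x)

/-- Face maps `d₀, …, d_{l+1}` with `d₀ = d_{l+1} = 0` and given inner face maps `d₁, …, d_l`. -/
def innerFaces {X : Type*} [Zero X] {l : ℕ} (d : Fin l → X) : Fin (l + 2) → X :=
  Fin.cases 0 (Fin.lastCases 0 d)

/-- The order complex `k[Δ_*(Π^{(d)})]`. The inner face `dᵢ`, for `0 < i < l`, omits the element
`xᵢ` of a chain `x₀ < ⋯ < x_l`; the outer faces `d₀` and `d_l` are zero. -/
def orderComplex (k : Type w) [CommRing k] {P : SetOperad.{u}}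
    (H : HomogeneousPresentation.{u, v} P) (d : ℕ) : PresimplicialData k where
  obj l I _ _ := H.Chain d I l →₀ k
  act _ _ _ _ _ _ _ e := Finsupp.lmapDomain k k fun c => c.map e
  face _ _ _ _ := innerFaces fun i => Finsupp.lmapDomain k k fun c => c.drop i

/-! ### Linear operads and linearisation -/

/-- A map from a product of modules is multilinear. -/
structure IsMultilinear (k : Type u) [CommRing k] {V : Type} {M : V → Type v} {N : Type w}
    [∀ v, AddCommGroup (M v)] [∀ v, Module k (M v)] [AddCommGroup N] [Module k N]
    (F : (∀ v, M v) → N) : Prop where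
  add : ∀ [DecidableEq V] (q : ∀ v, M v) (v : V) (x y : M v),
    F (Function.update q v (x + y)) = F (Function.update q v x) + F (Function.update q v y)
  smul : ∀ [DecidableEq V] (q : ∀ v, M v) (v : V) (a : k) (x : M v),
    F (Function.update q v (a • x)) = a • F (Function.update q v x)

/-- Bijections act linearly and the compositions are multilinear. -/
structure LinearOps (k : Type u) [CommRing k] (A : PreOperad.{v})
    [∀ (I : Type) [Finite I], AddCommGroup (A.obj I)]
    [∀ (I : Type) [Finite I], Module k (A.obj I)] : Prop where
  map_add : ∀ {I J : Type} [Finite I] [Finite J] (e : I ≃ J) (x y : A.obj I),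
    A.map e (x + y) = A.map e x + A.map e y
  map_smul : ∀ {I J : Type} [Finite I] [Finite J] (e : I ≃ J) (a : k) (x : A.obj I),
    A.map e (a • x) = a • A.map e x
  comp_add : ∀ {I J : Type} [Finite I] [Finite J] (f : I → J) (p p' : A.obj J)
    (q : A.Fam f), A.comp f (p + p') q = A.comp f p q + A.comp f p' q
  comp_smul : ∀ {I J : Type} [Finite I] [Finite J] (f : I → J) (a : k) (p : A.obj J)
    (q : A.Fam f), A.comp f (a • p) q = a • A.comp f p q
  comp_multilinear : ∀ {I J : Type} [Finite I] [Finite J] (f : I → J) (p : A.obj J),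
    IsMultilinear k fun q : A.Fam f => A.comp f p q

/-- A symmetric operad in `k`-modules: an operad whose sets of operations are `k`-modules, with
linear actions of bijections and multilinear compositions. -/
structure LinOperad (k : Type u) [CommRing k] extends SetOperad.{v} where
  [acg : ∀ (I : Type) [Finite I], AddCommGroup (obj I)]
  [mod : ∀ (I : Type) [Finite I], Module k (obj I)]
  linear : LinearOps k toPreOperad

attribute [instance] LinOperad.acg LinOperad.mod

section Linearize

variable (k : Type u) [CommRing k] (P : SetOperad.{v})

/-- The linear extension of the composition of a set operad. -/
def linComp {I J : Type} [Finite I] [Finite J] (f : I → J) :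
    (P.obj J →₀ k) →ₗ[k]
      MultilinearMap k (fun j => P.obj (Fib f j) →₀ k) (P.obj I →₀ k) :=
  Finsupp.linearCombination k fun p =>
    ((Basis.piTensorProduct fun j =>
        (Finsupp.basisSingleOne : Module.Basis (P.obj (Fib f j)) k _)).constr k
      fun q => Finsupp.single (P.comp f p q) (1 : k)).compMultilinearMap (PiTensorProduct.tprod k)

theorem linComp_single {I J : Type} [Finite I] [Finite J] (f : I → J) (p : P.obj J)
    (q : P.Fam f) :
    linComp k P f (Finsupp.single p 1) (fun j => Finsupp.single (q j) 1) =
      Finsupp.single (P.comp f p q) 1 := by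
  have h := (Basis.piTensorProduct fun j =>
        (Finsupp.basisSingleOne : Module.Basis (P.obj (Fib f j)) k _)).constr_basis k
      (fun q => Finsupp.single (P.comp f p q) (1 : k)) q
  rw [Basis.piTensorProduct_apply] at h
  simpa [linComp] using h

/-- The operations of the linear operad `k⟨P⟩`. -/
def preLinearize : PreOperad.{max u v} where
  obj I _ := P.obj I →₀ k
  map e := Finsupp.mapDomain (P.map e)
  one := Finsupp.single P.one 1
  comp f p q := linComp k P f p q

end Linearize

namespace IsMultilinear

variable {k : Type u} [CommRing k] {V : Type}

theorem ext_single [Finite V] {κ : V → Type v} {N : Type w} [AddCommGroup N] [Module k N]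
    {F G : (∀ v, κ v →₀ k) → N} (hF : IsMultilinear k F) (hG : IsMultilinear k G)
    (h : ∀ q : ∀ v, κ v, F (fun v => Finsupp.single (q v) 1) = G fun v => Finsupp.single (q v) 1)
    (q : ∀ v, κ v →₀ k) : F q = G q := by
  let F' : MultilinearMap k (fun v => κ v →₀ k) N := ⟨F, fun m => hF.add m, fun m => hF.smul m⟩
  let G' : MultilinearMap k (fun v => κ v →₀ k) N := ⟨G, fun m => hG.add m, fun m => hG.smul m⟩
  have : F' = G' := by
    refine Module.Basis.ext_multilinear (fun v => Finsupp.basisSingleOne) fun v => ?_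
    simp only [Finsupp.coe_basisSingleOne]
    exact h v
  exact congrArg (fun f : MultilinearMap k (fun v => κ v →₀ k) N => f q) this

variable {W : Type} {M : V → Type v} {M' : W → Type v} {N : Type w} {N' : Type*}
  [∀ v, AddCommGroup (M v)] [∀ v, Module k (M v)] [∀ v, AddCommGroup (M' v)]
  [∀ v, Module k (M' v)] [AddCommGroup N] [Module k N] [AddCommGroup N'] [Module k N']

/-- Each argument of `F` affects a single component of its value, on which it acts linearly. -/
def Separate (k : Type u) [CommRing k] {V W : Type} {M : V → Type v} {M' : W → Type v}
    [∀ v, AddCommGroup (M v)] [∀ v, Module k (M v)] [∀ v, AddCommGroup (M' v)]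
    [∀ v, Module k (M' v)] (F : (∀ v, M v) → ∀ w, M' w) : Prop :=
  ∀ (_ : DecidableEq V) (_ : DecidableEq W) (v : V) (q : ∀ v, M v),
    ∃ (w : W) (L : M v →ₗ[k] M' w), ∀ x, F (Function.update q v x) = Function.update (F q) w (L x)

theorem comp_separate {G : (∀ w, M' w) → N} (hG : IsMultilinear k G)
    {F : (∀ v, M v) → ∀ w, M' w} (hF : Separate k F) : IsMultilinear k fun q => G (F q) where
  add q v x y := by
    classical
    obtain ⟨w, L, h⟩ := hF inferInstance inferInstance v q
    simp only [h, _root_.map_add, hG.add]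
  smul q v a x := by
    classical
    obtain ⟨w, L, h⟩ := hF inferInstance inferInstance v q
    simp only [h, _root_.map_smul, hG.smul]

theorem linear_comp {F : (∀ v, M v) → N} (hF : IsMultilinear k F) (L : N →ₗ[k] N') :
    IsMultilinear k fun q => L (F q) where
  add q v x y := by simp [hF.add]
  smul q v a x := by simp [hF.smul]

theorem of_multilinearMap (F : MultilinearMap k M N) : IsMultilinear k fun q => F q where
  add q v x y := F.map_update_add q v x y
  smul q v a x := F.map_update_smul q v a x

/-- The linear map out of a tensor product defined by a multilinear map. -/
def lift {F : (∀ v, M v) → N} (hF : IsMultilinear k F) : (⨂[k] v, M v) →ₗ[k] N :=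
  PiTensorProduct.lift ⟨F, fun m => hF.add m, fun m => hF.smul m⟩

@[simp]
theorem lift_tprod {F : (∀ v, M v) → N} (hF : IsMultilinear k F) (q : ∀ v, M v) :
    hF.lift (PiTensorProduct.tprod k q) = F q :=
  PiTensorProduct.lift.tprod _

end IsMultilinear

section Separate

open IsMultilinear

variable {k : Type u} [CommRing k]

namespace LinearOps

variable {A : PreOperad.{v}} [∀ (I : Type) [Finite I], AddCommGroup (A.obj I)]
  [∀ (I : Type) [Finite I], Module k (A.obj I)]

/-- The action of a bijection as a linear map. -/
def mapL (hA : LinearOps k A) {I J : Type} [Finite I] [Finite J] (e : I ≃ J) : A.obj I →ₗ[k] A.obj J where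
  toFun := A.map e
  map_add' := hA.map_add e
  map_smul' := hA.map_smul e

/-- Composition as a linear map in its outer argument. -/
def compL (hA : LinearOps k A) {I J : Type} [Finite I] [Finite J] (f : I → J) (q : A.Fam f) :
    A.obj J →ₗ[k] A.obj I where
  toFun p := A.comp f p q
  map_add' p p' := hA.comp_add f p p' q
  map_smul' a p := hA.comp_smul f a p q

/-- Composition as a linear map in one of its inner arguments. -/
def compR (hA : LinearOps k A) [∀ J : Type, DecidableEq J] {I J : Type} [Finite I] [Finite J] (f : I → J)
    (p : A.obj J) (q : A.Fam f) (j : J) :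
    A.obj (Fib f j) →ₗ[k] A.obj I where
  toFun x := A.comp f p (Function.update q j x)
  map_add' := (hA.comp_multilinear f p).add q j
  map_smul' := (hA.comp_multilinear f p).smul q j

theorem separate_famMap (hA : LinearOps k A) {I J I' J' : Type} [Finite I] [Finite I'] (e : I ≃ I') (h : J ≃ J')
    (f : I → J) (f' : I' → J') (w : ∀ i, f' (e i) = h (f i)) :
    Separate k fun q : A.Fam f => A.famMap e h f f' w q := by
  intro _ _ j q
  obtain ⟨j', rfl⟩ := h.symm.surjective j
  refine ⟨j', hA.mapL (fibSquare e h f f' w j'), fun x => ?_⟩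
  funext j''
  by_cases hj : j'' = j'
  · subst hj
    simp [PreOperad.famMap, mapL]
  · have : h.symm j'' ≠ h.symm j' := fun h' => hj (h.symm.injective h')
    simp [PreOperad.famMap, hj]

theorem separate_famComp_left (hA : LinearOps k A) {I J K : Type} [Finite I] [Finite J] (f : I → J) (g : J → K)
    (h : I → K) (hc : ∀ i, g (f i) = h i) (r : A.Fam f) :
    Separate k fun q : A.Fam g => A.famComp f g h hc q r := by
  intro _ _ c q
  refine ⟨c, hA.compL (fibMap f g h hc c)
    (fun j => A.map (fibFib f g h hc c j) (r j.1)), fun x => ?_⟩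
  funext c'
  by_cases hc' : c' = c
  · subst hc'
    simp only [PreOperad.famComp, Function.update_self]
    rfl
  · simp [PreOperad.famComp, hc']

theorem separate_famComp_right (hA : LinearOps k A) {I J K : Type} [Finite I] [Finite J] (f : I → J) (g : J → K)
    (h : I → K) (hc : ∀ i, g (f i) = h i) (q : A.Fam g) :
    Separate k fun r : A.Fam f => A.famComp f g h hc q r := by
  intro _ _ j r
  classical
  refine ⟨g j, (hA.compR (fibMap f g h hc (g j)) (q (g j))
    (fun b => A.map (fibFib f g h hc (g j) b) (r b.1)) ⟨j, rfl⟩).comp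
      (hA.mapL (fibFib f g h hc (g j) ⟨j, rfl⟩)), fun x => ?_⟩
  funext c
  by_cases hcj : c = g j
  · subst hcj
    simp only [PreOperad.famComp, Function.update_self, LinearMap.comp_apply]
    simp only [compR, mapL, LinearMap.coe_mk, AddHom.coe_mk]
    congr 1
    funext b
    by_cases hb : b = ⟨j, rfl⟩
    · subst hb
      simp
    · have : b.1 ≠ j := fun h' => hb (Subtype.ext h')
      simp [hb, this]
  · simp only [PreOperad.famComp, Function.update_of_ne hcj]
    congr 1
    funext b
    have : b.1 ≠ j := fun h' => hcj (by rw [← h', b.2])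
    simp [this]

end LinearOps

end Separate

section Linearize

variable (k : Type u) [CommRing k] (P : SetOperad.{v})

instance (I : Type) [Finite I] : AddCommGroup ((preLinearize k P).obj I) :=
  inferInstanceAs (AddCommGroup (P.obj I →₀ k))

instance (I : Type) [Finite I] : Module k ((preLinearize k P).obj I) :=
  inferInstanceAs (Module k (P.obj I →₀ k))

theorem linearOps : LinearOps k (preLinearize k P) where
  map_add _ _ _ := Finsupp.mapDomain_add
  map_smul _ _ _ := Finsupp.mapDomain_smul _ _
  comp_add f p p' q :=
    congrArg (fun F => F q) (_root_.map_add (linComp k P f) p p')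
  comp_smul f a p q :=
    congrArg (fun F => F q) (_root_.map_smul (linComp k P f) a p)
  comp_multilinear f p := IsMultilinear.of_multilinearMap (linComp k P f p)

theorem preLinearize_map_single {I J : Type} [Finite I] [Finite J] (e : I ≃ J) (x : P.obj I) :
    (preLinearize k P).map e (Finsupp.single x 1) = Finsupp.single (P.map e x) 1 :=
  Finsupp.mapDomain_single

theorem preLinearize_comp_single {I J : Type} [Finite I] [Finite J] (f : I → J) (p : P.obj J)
    (q : P.Fam f) :
    (preLinearize k P).comp f (Finsupp.single p 1) (fun j => Finsupp.single (q j) 1) =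
      Finsupp.single (P.comp f p q) 1 :=
  linComp_single k P f p q

theorem preLinearize_famMap_single {I J I' J' : Type} [Finite I] [Finite I'] (e : I ≃ I')
    (h : J ≃ J') (f : I → J) (f' : I' → J') (w : ∀ i, f' (e i) = h (f i)) (q : P.Fam f) :
    (preLinearize k P).famMap e h f f' w (fun j => Finsupp.single (q j) 1) =
      fun j => Finsupp.single (P.famMap e h f f' w q j) 1 :=
  funext fun _ => preLinearize_map_single k P _ _

theorem preLinearize_famComp_single {I J K : Type} [Finite I] [Finite J] (f : I → J) (g : J → K)
    (h : I → K) (hc : ∀ i, g (f i) = h i) (q : P.Fam g) (r : P.Fam f) :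
    (preLinearize k P).famComp f g h hc (fun j => Finsupp.single (q j) 1)
        (fun j => Finsupp.single (r j) 1) =
      fun c => Finsupp.single (P.famComp f g h hc q r c) 1 := by
  funext c
  simp only [PreOperad.famComp, preLinearize_map_single, preLinearize_comp_single]
  rfl

theorem lin_ext {X : Type v} {N : Type w} [AddCommGroup N] [Module k N]
    (F G : (X →₀ k) →ₗ[k] N) (h : ∀ x, F (Finsupp.single x 1) = G (Finsupp.single x 1))
    (p : X →₀ k) : F p = G p :=
  congrArg (fun f : (X →₀ k) →ₗ[k] N => f p) (Finsupp.lhom_ext' fun x => LinearMap.ext_ring (h x))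

/-- The linear operad `k⟨P⟩` associated with a set operad `P`. -/
def linearize : LinOperad.{u, max u v} k where
  toPreOperad := preLinearize k P
  acg I _ := inferInstanceAs (AddCommGroup (P.obj I →₀ k))
  mod I _ := inferInstanceAs (Module k (P.obj I →₀ k))
  map_refl {I} _ x := lin_ext k ((linearOps k P).mapL (Equiv.refl I)) LinearMap.id
    (fun x => by
      refine (preLinearize_map_single k P _ x).trans ?_
      rw [P.map_refl]
      rfl) x
  map_trans e e' x := lin_ext k ((linearOps k P).mapL (e.trans e'))
    (((linearOps k P).mapL e').comp ((linearOps k P).mapL e))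
    (fun x => by
      refine (preLinearize_map_single k P _ x).trans ?_
      rw [P.map_trans]
      refine (preLinearize_map_single k P e' _).symm.trans ?_
      exact congrArg _ (preLinearize_map_single k P e x).symm) x
  comp_map {I J I' J'} _ _ _ _ e h f f' w p q := by
    refine lin_ext k (((linearOps k P).compL f' _).comp ((linearOps k P).mapL h))
      (((linearOps k P).mapL e).comp ((linearOps k P).compL f q)) (fun p => ?_) p
    refine IsMultilinear.ext_single (k := k)
      (F := fun q : (preLinearize k P).Fam f => (preLinearize k P).comp f'
        ((preLinearize k P).map h (Finsupp.single p 1)) ((preLinearize k P).famMap e h f f' w q))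
      (G := fun q : (preLinearize k P).Fam f => (preLinearize k P).map e
        ((preLinearize k P).comp f (Finsupp.single p 1) q))
      (((linearOps k P).comp_multilinear f' _).comp_separate
        ((linearOps k P).separate_famMap e h f f' w))
      (((linearOps k P).comp_multilinear f _).linear_comp ((linearOps k P).mapL e))
      (fun q => ?_) q
    simp only [preLinearize_famMap_single, preLinearize_map_single, preLinearize_comp_single]
    rw [← P.comp_map e h f f' w]
  one_comp f q := by
    refine IsMultilinear.ext_single (k := k)
      (F := fun q : (preLinearize k P).Fam f => (preLinearize k P).comp f
        (Finsupp.single P.one 1) q)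
      (G := fun q : (preLinearize k P).Fam f => (preLinearize k P).map (fibUnit f) (q ()))
      ((linearOps k P).comp_multilinear f _) ⟨fun q v x y => ?_, fun q v a x => ?_⟩
      (fun q => ?_) q
    · simp only [Function.update_self]
      exact (linearOps k P).map_add (fibUnit f) x y
    · simp only [Function.update_self]
      exact (linearOps k P).map_smul (fibUnit f) a x
    · simp only [preLinearize_comp_single, P.one_comp]
      exact (preLinearize_map_single k P (fibUnit f) (q ())).symm
  comp_one {I} _ p := by
    refine lin_ext k ((linearOps k P).compL _ _) LinearMap.id (fun p => ?_) p
    have h : (preLinearize k P).famOne I = fun i => Finsupp.single (P.famOne I i) 1 :=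
      funext fun i => preLinearize_map_single k P _ _
    change (preLinearize k P).comp _ _ _ = _
    rw [h, preLinearize_comp_single, P.comp_one]
    rfl
  comp_assoc f g p q r := by
    refine lin_ext k (((linearOps k P).compL f r).comp ((linearOps k P).compL g q))
      ((linearOps k P).compL _ _) (fun p => ?_) p
    refine IsMultilinear.ext_single (k := k)
      (F := fun q : (preLinearize k P).Fam g => (preLinearize k P).comp f
        ((preLinearize k P).comp g (Finsupp.single p 1) q) r)
      (G := fun q : (preLinearize k P).Fam g => (preLinearize k P).comp _ (Finsupp.single p 1)
        ((preLinearize k P).famComp f g (fun i => g (f i)) (fun _ => rfl) q r))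
      (((linearOps k P).comp_multilinear g _).linear_comp ((linearOps k P).compL f r))
      (((linearOps k P).comp_multilinear _ _).comp_separate
        ((linearOps k P).separate_famComp_left f g _ _ r)) (fun q => ?_) q
    refine IsMultilinear.ext_single (k := k)
      (F := fun r : (preLinearize k P).Fam f => (preLinearize k P).comp f
        ((preLinearize k P).comp g (Finsupp.single p 1) fun j => Finsupp.single (q j) 1) r)
      (G := fun r : (preLinearize k P).Fam f => (preLinearize k P).comp _ (Finsupp.single p 1)
        ((preLinearize k P).famComp f g (fun i => g (f i)) (fun _ => rfl)
          (fun j => Finsupp.single (q j) 1) r))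
      ((linearOps k P).comp_multilinear f _)
      (((linearOps k P).comp_multilinear _ _).comp_separate
        ((linearOps k P).separate_famComp_right f g _ _ _)) (fun r => ?_) r
    simp only [preLinearize_famComp_single, preLinearize_comp_single, P.comp_assoc]
    rfl
  linear := linearOps k P

end Linearize

/-! ### Levelled trees and the bar construction -/

/-- A levelled tree with `l` levels and set of leaves `I`, without labels: a sequence of
partitions of `I`, each coarser than the previous one, starting with the partition into points and
ending with the partition with a single block. The levels are numbered from the leaves to the
root. -/
@[ext]
structure LevelShape (I : Type) (l : ℕ) where
  part : Fin (l + 1) → Setoid I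
  mono : Monotone part
  part_zero : part 0 = ⊥
  part_last : part (Fin.last l) = ⊤

namespace LevelShape

variable {I : Type} {l : ℕ} (π : LevelShape I l)

/-- The map from the edges entering level `j` to the edges leaving it. -/
def level (j : Fin l) : Quotient (π.part j.castSucc) → Quotient (π.part j.succ) :=
  qmap (π.mono (Fin.castSucc_lt_succ (i := j)).le)

/-- The vertices of a levelled tree. -/
abbrev Vertex : Type := Σ j : Fin l, Quotient (π.part j.succ)

/-- The set of edges entering a vertex. -/
abbrev In (v : π.Vertex) : Type := Fib (π.level v.1) v.2

/-- The action of bijections on levelled trees. -/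
def map {J : Type} (e : I ≃ J) : LevelShape J l where
  part j := (π.part j).comap e.symm
  mono _ _ h := comap_le_comap e (π.mono h)
  part_zero := by
    rw [π.part_zero]
    exact Setoid.ext fun a b => e.symm.injective.eq_iff
  part_last := by rw [π.part_last]; rfl

/-- The levelled tree obtained by merging two consecutive levels. -/
def merge (π : LevelShape I (l + 1)) (i : Fin l) : LevelShape I l where
  part a := π.part (i.castSucc.succ.succAbove a)
  mono := π.mono.comp (Fin.strictMono_succAbove _).monotone
  part_zero := by rw [Fin.succAbove_ne_zero_zero (Fin.succ_ne_zero _), π.part_zero]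
  part_last := by
    rw [Fin.succAbove_ne_last_last fun h => (Fin.castSucc_lt_last i).ne (Fin.succ_injective _ h),
      π.part_last]

theorem merge_part_of_le (π : LevelShape I (l + 1)) {i : Fin l} {a : Fin (l + 1)}
    (h : (a : ℕ) ≤ i) : π.part a.castSucc = (π.merge i).part a :=
  congrArg π.part (Fin.succAbove_of_castSucc_lt _ _ (Fin.lt_def.2 (by simpa using by omega))).symm

theorem merge_part_of_lt (π : LevelShape I (l + 1)) {i : Fin l} {a : Fin (l + 1)}
    (h : (i : ℕ) < a) : π.part a.succ = (π.merge i).part a :=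
  congrArg π.part (Fin.succAbove_of_le_castSucc _ _ (Fin.le_def.2 (by simpa using by omega))).symm

theorem part_castSucc_le (π : LevelShape I (l + 1)) (j : Fin l) :
    π.part j.castSucc.castSucc ≤ π.part j.succ.succ :=
  π.mono (Fin.le_def.2 (by simp; omega))

end LevelShape

namespace PreOperad

variable (P : PreOperad.{u}) {I : Type} [Finite I]

/-- Transport of a family of operations along equalities of partitions. -/
def famCast {σ τ σ' τ' : Setoid I} (h : σ ≤ τ) (h' : σ' ≤ τ') (hσ : σ = σ') (hτ : τ = τ')
    (q : P.Fam (qmap h)) : P.Fam (qmap h') := by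
  subst hσ hτ
  exact q

/-- The labels of a levelled tree, level by level. -/
abbrev Labels {l : ℕ} (π : LevelShape I l) : Type u := ∀ j : Fin l, P.Fam (π.level j)

/-- The action of bijections on labels. -/
def mapLabels {J : Type} [Finite J] {l : ℕ} (e : I ≃ J) {π : LevelShape I l} (y : P.Labels π) :
    P.Labels (π.map e) := fun j =>
  P.famMap (quotEquiv e _) (quotEquiv e _) _ _ (qmap_quotEquiv e _) (y j)

/-- Composition of the labels at two consecutive levels. -/
def mergeLabels {l : ℕ} {π : LevelShape I (l + 1)} (i : Fin l) (y : P.Labels π) :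
    P.Labels (π.merge i) := fun j =>
  if h : (j : ℕ) < i then
    P.famCast _ _ (π.merge_part_of_le (a := j.castSucc) h.le) (π.merge_part_of_le (a := j.succ) h)
      (y j.castSucc)
  else if h' : (i : ℕ) < j then
    P.famCast _ _ (π.merge_part_of_lt (a := j.castSucc) h')
      (π.merge_part_of_lt (a := j.succ) (h'.trans (Nat.lt_succ_self _))) (y j.succ)
  else
    P.famCast (π.part_castSucc_le j) _
      (π.merge_part_of_le (a := j.castSucc) (not_lt.1 h'))
      (π.merge_part_of_lt (a := j.succ) (Nat.lt_succ_of_le (not_lt.1 h)))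
      (P.famComp (π.level j.castSucc) (π.level j.succ) _
        (fun b => Quotient.inductionOn b fun _ => rfl) (y j.succ) (y j.castSucc))

section

variable {l : ℕ} {π : LevelShape I (l + 1)} {i j : Fin l} (y : P.Labels π)

theorem mergeLabels_lt (h : (j : ℕ) < i) : P.mergeLabels i y j =
    P.famCast _ _ (π.merge_part_of_le (a := j.castSucc) h.le) (π.merge_part_of_le (a := j.succ) h)
      (y j.castSucc) := dif_pos h

theorem mergeLabels_gt (h : (i : ℕ) < j) : P.mergeLabels i y j =
    P.famCast _ _ (π.merge_part_of_lt (a := j.castSucc) h)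
      (π.merge_part_of_lt (a := j.succ) (h.trans (Nat.lt_succ_self _))) (y j.succ) :=
  (dif_neg h.not_gt).trans (dif_pos h)

theorem mergeLabels_eq (h : (j : ℕ) = i) : P.mergeLabels i y j =
    P.famCast (π.part_castSucc_le j) _ (π.merge_part_of_le (a := j.castSucc) h.le)
      (π.merge_part_of_lt (a := j.succ) (Nat.lt_succ_of_le h.ge))
      (P.famComp (π.level j.castSucc) (π.level j.succ) _
        (fun b => Quotient.inductionOn b fun _ => rfl) (y j.succ) (y j.castSucc)) :=
  (dif_neg h.ge.not_gt).trans (dif_neg h.le.not_gt)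

theorem mergeLabels_congr {y' : P.Labels π} (h₁ : (j : ℕ) ≤ i → y j.castSucc = y' j.castSucc)
    (h₂ : (i : ℕ) ≤ j → y j.succ = y' j.succ) : P.mergeLabels i y j = P.mergeLabels i y' j := by
  rcases lt_trichotomy (j : ℕ) i with h | h | h
  · rw [mergeLabels_lt _ _ h, mergeLabels_lt _ _ h, h₁ h.le]
  · rw [mergeLabels_eq _ _ h, mergeLabels_eq _ _ h, h₁ h.le, h₂ h.ge]
  · rw [mergeLabels_gt _ _ h, mergeLabels_gt _ _ h, h₂ h.le]

end

end PreOperad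

namespace IsMultilinear

theorem separate_id {k : Type u} [CommRing k] {V : Type} {M : V → Type v}
    [∀ v, AddCommGroup (M v)] [∀ v, Module k (M v)] : Separate k fun q : ∀ v, M v => q := by
  intro dV dW v q
  obtain rfl : dV = dW := Subsingleton.elim _ _
  exact ⟨v, LinearMap.id, fun x => rfl⟩

theorem separate_sigma {k : Type u} [CommRing k] {V W : Type} {A : V → Type} {B : W → Type}
    {M : ∀ m, A m → Type v} {N : ∀ j, B j → Type v}
    [∀ m a, AddCommGroup (M m a)] [∀ m a, Module k (M m a)]
    [∀ j b, AddCommGroup (N j b)] [∀ j b, Module k (N j b)]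
    (F : (∀ m a, M m a) → ∀ j b, N j b)
    (hF : ∀ (_ : DecidableEq V) (m : V) (y : ∀ m a, M m a), ∃ j₀,
      (Separate k fun z : ∀ a, M m a => F (Function.update y m z) j₀) ∧
      ∀ j, j ≠ j₀ → ∀ z, F (Function.update y m z) j = F y j) :
    Separate k fun (q : ∀ v : Σ m, A m, M v.1 v.2) (w : Σ j, B j) =>
      F (fun m a => q ⟨m, a⟩) w.1 w.2 := by
  classical
  rintro _ _ ⟨m, a⟩ q
  obtain ⟨j₀, h₁, h₂⟩ := hF inferInstance m fun m a => q ⟨m, a⟩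
  obtain ⟨b, L, hL⟩ := h₁ inferInstance inferInstance a fun a => q ⟨m, a⟩
  refine ⟨⟨j₀, b⟩, L, fun x => ?_⟩
  have hc : (fun m' a' => Function.update q ⟨m, a⟩ x ⟨m', a'⟩) =
      Function.update (fun m a => q ⟨m, a⟩) m (Function.update (fun a => q ⟨m, a⟩) a x) := by
    funext m' a'
    by_cases hm : m' = m
    · subst hm
      by_cases ha : a' = a
      · subst ha; simp
      · have : (⟨m', a'⟩ : Σ m, A m) ≠ ⟨m', a⟩ := fun h => ha (by cases h; rfl)
        simp [ha]
    · have : (⟨m', a'⟩ : Σ m, A m) ≠ ⟨m, a⟩ := fun h => hm (by cases h; rfl)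
      simp [hm, this]
  funext ⟨j, b'⟩
  simp only [hc]
  by_cases hj : j = j₀
  · subst hj
    refine (congrFun (hL x) b').trans ?_
    simp only [Function.update_eq_self]
    by_cases hb : b' = b
    · subst hb; simp
    · have : (⟨j, b'⟩ : Σ j, B j) ≠ ⟨j, b⟩ := fun h => hb (by cases h; rfl)
      simp [hb]
  · have : (⟨j, b'⟩ : Σ j, B j) ≠ ⟨j₀, b⟩ := fun h => hj (by cases h; rfl)
    rw [h₂ j hj, Function.update_of_ne this]

end IsMultilinear

namespace LinearOps

open IsMultilinear

variable {k : Type u} [CommRing k] {A : PreOperad.{v}}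
  [∀ (I : Type) [Finite I], AddCommGroup (A.obj I)]
  [∀ (I : Type) [Finite I], Module k (A.obj I)] {I : Type} [Finite I]

theorem separate_famCast {V : Type} {M : V → Type v} [∀ v, AddCommGroup (M v)]
    [∀ v, Module k (M v)] {σ τ σ' τ' : Setoid I} (h : σ ≤ τ) (h' : σ' ≤ τ')
    (hσ : σ = σ') (hτ : τ = τ') {F : (∀ v, M v) → A.Fam (qmap h)} (hF : Separate k F) :
    Separate k fun q => A.famCast h h' hσ hτ (F q) := by
  subst hσ hτ
  exact hF

theorem separate_mapLabels (hA : LinearOps k A) {J : Type} [Finite J] {l : ℕ} (e : I ≃ J) (π : LevelShape I l) :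
    Separate k fun (q : ∀ v : π.Vertex, A.obj (π.In v)) (w : (π.map e).Vertex) =>
      A.mapLabels e (fun m a => q ⟨m, a⟩) w.1 w.2 := by
  refine separate_sigma (k := k) (fun y : A.Labels π => A.mapLabels e y) fun _ m y => ⟨m, ?_, ?_⟩
  · simp only [PreOperad.mapLabels, Function.update_self]
    exact hA.separate_famMap _ _ _ _ _
  · intro j hj z
    simp only [PreOperad.mapLabels, Function.update_of_ne hj]
    rfl

theorem separate_mergeLabels (hA : LinearOps k A) {l : ℕ} (i : Fin l) (π : LevelShape I (l + 1)) :
    Separate k fun (q : ∀ v : π.Vertex, A.obj (π.In v)) (w : (π.merge i).Vertex) =>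
      A.mergeLabels i (fun m a => q ⟨m, a⟩) w.1 w.2 := by
  refine separate_sigma (k := k) (fun y : A.Labels π => A.mergeLabels i y) fun _ m y => ?_
  have ne₁ : ∀ {a b : Fin (l + 1)}, (a : ℕ) ≠ b → a ≠ b := fun h h' => h (congrArg _ h')
  have hi := i.2
  have hm := m.2
  rcases lt_trichotomy (m : ℕ) i with h | h | h
  · obtain ⟨j₀, rfl⟩ : ∃ j₀ : Fin l, m = j₀.castSucc := ⟨⟨m, by omega⟩, rfl⟩
    refine ⟨j₀, ?_, fun j hj z => A.mergeLabels_congr _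
      (fun _ => Function.update_of_ne (ne₁ (by simpa using fun h => hj (Fin.ext h))) _ _)
      (fun _ => Function.update_of_ne (ne₁ (by simp at h ⊢; omega)) _ _)⟩
    rw [funext fun z => A.mergeLabels_lt (Function.update y j₀.castSucc z) h]
    simp only [Function.update_self]
    exact separate_famCast _ _ _ _ separate_id
  · obtain ⟨j₀, rfl⟩ : ∃ j₀ : Fin l, m = j₀.castSucc := ⟨⟨m, by omega⟩, rfl⟩
    refine ⟨j₀, ?_, fun j hj z => A.mergeLabels_congr _
      (fun _ => Function.update_of_ne (ne₁ (by simpa using fun h => hj (Fin.ext h))) _ _)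
      (fun _ => Function.update_of_ne (ne₁ (by simp at h ⊢; omega)) _ _)⟩
    rw [funext fun z => A.mergeLabels_eq (Function.update y j₀.castSucc z) h]
    have h₃ : j₀.succ ≠ j₀.castSucc := ne₁ (by simp)
    simp only [Function.update_self, Function.update_of_ne h₃]
    exact separate_famCast _ _ _ _ (hA.separate_famComp_right _ _ _ _ _)
  · obtain ⟨j₀, rfl⟩ : ∃ j₀ : Fin l, m = j₀.succ :=
      ⟨⟨m - 1, by omega⟩, Fin.ext (by simp; omega)⟩
    rw [Fin.val_succ] at h
    refine ⟨j₀, ?_, fun j hj z => A.mergeLabels_congr _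
      (fun _ => Function.update_of_ne (ne₁ (by simp; omega)) _ _)
      (fun _ => Function.update_of_ne (ne₁ (by simpa using fun h => hj (Fin.ext h))) _ _)⟩
    rcases (Nat.lt_succ_iff.1 h).lt_or_eq with h' | h'
    · rw [funext fun z => A.mergeLabels_gt (Function.update y j₀.succ z) h']
      simp only [Function.update_self]
      exact separate_famCast _ _ _ _ separate_id
    · rw [funext fun z => A.mergeLabels_eq (Function.update y j₀.succ z) h'.symm]
      have h₁ : j₀.castSucc ≠ j₀.succ := ne₁ (by simp)
      simp only [Function.update_self, Function.update_of_ne h₁]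
      exact separate_famCast _ _ _ _ (hA.separate_famComp_left _ _ _ _ _)

end LinearOps

namespace LinOperad

variable {k : Type u} [CommRing k] (P : LinOperad.{u, v} k)

/-- A weight grading `P = ⨁ P^{(d)}` of a linear operad, with `P^{(0)}` spanned by the identity. -/
structure WeightGrading where
  sub : ℕ → (I : Type) → [Finite I] → Submodule k (P.obj I)
  isInternal : ∀ (I : Type) [Finite I], DirectSum.IsInternal fun d => sub d I
  sub_zero : ∀ (I : Type) [Finite I],
    sub 0 I = Submodule.span k (Set.range fun e : Unit ≃ I => P.map e P.one)
  map_mem : ∀ {I J : Type} [Finite I] [Finite J] (e : I ≃ J) {d : ℕ} {x : P.obj I},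
    x ∈ sub d I → P.map e x ∈ sub d J
  comp_mem : ∀ {I J : Type} [Finite I] [Finite J] (f : I → J) {a : ℕ} {b : J → ℕ} {p : P.obj J}
    {q : P.Fam f}, p ∈ sub a J → (∀ j, q j ∈ sub (b j) (Fib f j)) →
      P.comp f p q ∈ sub (a + ∑ᶠ j, b j) I

/-- The tensor product, over the vertices of a levelled tree, of the modules of operations whose
inputs are the edges entering the vertex. -/
abbrev TreeTensor {I : Type} [Finite I] {l : ℕ} (π : LevelShape I l) : Type (max u v) :=
  ⨂[k] v : π.Vertex, P.obj (π.In v)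

/-- The degree `l` component of the simplicial bar construction: the `l`-fold composite product
`P ∘ ⋯ ∘ P`, i.e. the module of all levelled trees with `l` levels and labels in `P`. -/
abbrev Bar (l : ℕ) (I : Type) [Finite I] : Type (max u v) :=
  ⨁ π : LevelShape I l, P.TreeTensor π

open Classical in
/-- A levelled tree with labels, as an element of the simplicial bar construction. -/
def tree {l : ℕ} {I : Type} [Finite I] (π : LevelShape I l) (y : P.Labels π) : P.Bar l I :=
  DirectSum.lof k (LevelShape I l) (fun π => P.TreeTensor π) π
    (PiTensorProduct.tprod k fun v : π.Vertex => y v.1 v.2)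

open Classical in
/-- The action of bijections on the bar construction. -/
def barMap {l : ℕ} {I J : Type} [Finite I] [Finite J] (e : I ≃ J) : P.Bar l I →ₗ[k] P.Bar l J :=
  DirectSum.toModule k _ _ fun π =>
    (DirectSum.lof k (LevelShape J l) (fun π => P.TreeTensor π) (π.map e)).comp
      ((IsMultilinear.of_multilinearMap (PiTensorProduct.tprod k)).comp_separate
        (P.linear.separate_mapLabels e π)).lift

open Classical in
/-- The face of the bar construction composing two consecutive levels. -/
def barMerge {l : ℕ} {I : Type} [Finite I] (i : Fin l) : P.Bar (l + 1) I →ₗ[k] P.Bar l I :=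
  DirectSum.toModule k _ _ fun π =>
    (DirectSum.lof k (LevelShape I l) (fun π => P.TreeTensor π) (π.merge i)).comp
      ((IsMultilinear.of_multilinearMap (PiTensorProduct.tprod k)).comp_separate
        (P.linear.separate_mergeLabels i π)).lift

theorem barMap_tree {l : ℕ} {I J : Type} [Finite I] [Finite J] (e : I ≃ J) (π : LevelShape I l)
    (y : P.Labels π) : P.barMap e (P.tree π y) = P.tree (π.map e) (P.mapLabels e y) := by
  simp [barMap, tree]

theorem barMerge_tree {l : ℕ} {I : Type} [Finite I] (i : Fin l) (π : LevelShape I (l + 1))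
    (y : P.Labels π) : P.barMerge i (P.tree π y) = P.tree (π.merge i) (P.mergeLabels i y) := by
  simp [barMerge, tree]

namespace WeightGrading

variable {P} (G : P.WeightGrading)

/-- A family of operations is homogeneous of weight `d` when its members are homogeneous and their
weights add up to `d`. -/
def Homogeneous {I J : Type} [Finite I] {f : I → J} (q : P.Fam f) (d : ℕ) : Prop :=
  ∃ a : J → ℕ, (∀ j, q j ∈ G.sub (a j) (Fib f j)) ∧ ∑ᶠ j, a j = d

variable {G}

theorem Homogeneous.famMap {I J I' J' : Type} [Finite I] [Finite I'] {e : I ≃ I'} {h : J ≃ J'}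
    {f : I → J} {f' : I' → J'} {w : ∀ i, f' (e i) = h (f i)} {q : P.Fam f} {d : ℕ}
    (hq : G.Homogeneous q d) : G.Homogeneous (P.famMap e h f f' w q) d := by
  obtain ⟨a, ha, rfl⟩ := hq
  exact ⟨fun j' => a (h.symm j'), fun j' => G.map_mem _ (ha _), finsum_comp_equiv h.symm⟩

theorem Homogeneous.famComp {I J K : Type} [Finite I] [Finite J] [Finite K] {f : I → J} {g : J → K}
    {h : I → K} {hc : ∀ i, g (f i) = h i} {q : P.Fam g} {r : P.Fam f} {d d' : ℕ}
    (hq : G.Homogeneous q d) (hr : G.Homogeneous r d') :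
    G.Homogeneous (P.famComp f g h hc q r) (d + d') := by
  obtain ⟨a, ha, rfl⟩ := hq
  obtain ⟨b, hb, rfl⟩ := hr
  refine ⟨fun c => a c + ∑ᶠ j : Fib g c, b j.1,
    fun c => G.comp_mem _ (ha c) fun j => G.map_mem _ (hb j.1), ?_⟩
  have := Fintype.ofFinite J
  have := Fintype.ofFinite K
  have hs : ∀ c, Fintype (Fib g c) := fun c => Fintype.ofFinite _
  simp only [finsum_eq_sum_of_fintype, Finset.sum_add_distrib]
  congr 1
  rw [← Fintype.sum_sigma' fun c (j : Fib g c) => b j.1]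
  exact Fintype.sum_equiv (Equiv.sigmaFiberEquiv g) _ _ fun _ => rfl

theorem Homogeneous.famCast {I : Type} [Finite I] {σ τ σ' τ' : Setoid I} {h : σ ≤ τ}
    {h' : σ' ≤ τ'} {hσ : σ = σ'} {hτ : τ = τ'} {q : P.Fam (qmap h)} {d : ℕ}
    (hq : G.Homogeneous q d) : G.Homogeneous (P.famCast h h' hσ hτ q) d := by
  subst hσ hτ
  exact hq

variable (G)

/-- The degree `l`, weight `d` component `N_l(P)^{(d)}` of the normalised bar construction: the
submodule of the simplicial bar construction spanned by the non-degenerate levelled trees of total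
weight `d`, where a tree is non-degenerate when every level has positive weight, i.e. when the
labels of no level are all multiples of the identity. -/
def normalised (d l : ℕ) (I : Type) [Finite I] : Submodule k (P.Bar l I) :=
  Submodule.span k {t | ∃ (π : LevelShape I l) (y : P.Labels π) (a : Fin l → ℕ),
    (∀ j, 0 < a j) ∧ ∑ j, a j = d ∧ (∀ j, G.Homogeneous (y j) (a j)) ∧ t = P.tree π y}

theorem barMap_mem (d : ℕ) {l : ℕ} {I J : Type} [Finite I] [Finite J] (e : I ≃ J) (x : P.Bar l I)
    (hx : x ∈ G.normalised d l I) : P.barMap e x ∈ G.normalised d l J := by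
  refine (Submodule.span_le (p := (G.normalised d l J).comap (P.barMap e))).2 ?_ hx
  rintro _ ⟨π, y, a, ha, hd, hy, rfl⟩
  refine Submodule.subset_span ⟨_, _, a, ha, hd, fun j => ?_, P.barMap_tree e π y⟩
  exact (hy j).famMap

theorem barMerge_mem (d : ℕ) {l : ℕ} {I : Type} [Finite I] (i : Fin l) (x : P.Bar (l + 1) I)
    (hx : x ∈ G.normalised d (l + 1) I) : P.barMerge i x ∈ G.normalised d l I := by
  refine (Submodule.span_le (p := (G.normalised d l I).comap (P.barMerge i))).2 ?_ hx
  rintro _ ⟨π, y, a, ha, hd, hy, rfl⟩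
  refine Submodule.subset_span ⟨_, _,
    fun j => a (i.succ.succAbove j) + if j = i then a i.succ else 0,
    fun j => Nat.add_pos_left (ha _) _, ?_, fun j => ?_, P.barMerge_tree i π y⟩
  · rw [← hd, Fin.sum_univ_succAbove a i.succ, Finset.sum_add_distrib]
    simp [add_comm]
  · rcases lt_trichotomy (j : ℕ) i with h | h | h
    · have h₁ : i.succ.succAbove j = j.castSucc :=
        Fin.succAbove_of_castSucc_lt _ _ (Fin.lt_def.2 (by simp; omega))
      have h₂ : j ≠ i := fun h' => h.ne (congrArg _ h')
      simp only [h₁, h₂, if_false, add_zero]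
      rw [P.mergeLabels_lt y h]
      exact (hy _).famCast
    · obtain rfl : j = i := Fin.ext h
      have h₁ : j.succ.succAbove j = j.castSucc :=
        Fin.succAbove_of_castSucc_lt _ _ (Fin.lt_def.2 (by simp))
      simp only [h₁, if_true]
      rw [P.mergeLabels_eq y rfl, add_comm (a _) (a _)]
      exact ((hy _).famComp (hy _)).famCast
    · have h₁ : i.succ.succAbove j = j.succ :=
        Fin.succAbove_of_le_castSucc _ _ (Fin.le_def.2 (by simp; omega))
      have h₂ : j ≠ i := fun h' => h.ne' (congrArg _ h')
      simp only [h₁, h₂, if_false, add_zero]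
      rw [P.mergeLabels_gt y h]
      exact Homogeneous.famCast (σ := π.part j.castSucc.succ) (τ := π.part j.succ.succ)
        (q := y j.succ) (hy j.succ)

/-- The weight `d` part `N_*(P)^{(d)}` of the normalised bar construction. The inner face `dᵢ`, for
`0 < i < l`, composes the `i`-th and `(i+1)`-st levels counted from the leaves. The outer faces `d₀`
and `d_l` are induced by the augmentation `P → P^{(0)}`, which vanishes on operations of positive
weight, so they are zero on non-degenerate trees. -/
def normalisedBar (d : ℕ) : PresimplicialData k where
  obj l I _ _ := G.normalised d l I
  act _ _ _ _ _ _ _ e := (P.barMap e).restrict (G.barMap_mem d e)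
  face _ _ _ _ := innerFaces fun i => (P.barMerge i).restrict (G.barMerge_mem d i)

end WeightGrading

end LinOperad

theorem linComp_mem (k : Type w) [CommRing k] (P : SetOperad.{u}) {I J : Type} [Finite I]
    [Finite J] (f : I → J) (p : P.obj J →₀ k) (q : ∀ j, P.obj (Fib f j) →₀ k)
    {S : Set (P.obj J)} {T : ∀ j, Set (P.obj (Fib f j))} {U : Set (P.obj I)}
    (hp : p ∈ Finsupp.supported k k S) (hq : ∀ j, q j ∈ Finsupp.supported k k (T j))
    (h : ∀ p₀ ∈ S, ∀ q₀ : P.Fam f, (∀ j, q₀ j ∈ T j) → P.comp f p₀ q₀ ∈ U) :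
    linComp k P f p q ∈ Finsupp.supported k k U := by
  have := Fintype.ofFinite J
  rw [linComp, Finsupp.linearCombination_apply, Finsupp.sum, sum_apply]
  refine Submodule.sum_mem _ fun p₀ hp₀ => Submodule.smul_mem _ _ ?_
  rw [LinearMap.compMultilinearMap_apply, Module.Basis.constr_apply]
  refine Submodule.sum_mem _ fun q₀ hq₀ => Submodule.smul_mem _ _ ?_
  refine Finsupp.single_mem_supported k _ (h p₀ ((Finsupp.mem_supported k _).1 hp hp₀) q₀ fun j => ?_)
  refine (Finsupp.mem_supported k _).1 (hq j) (Finsupp.mem_support_iff.2 fun h0 => ?_)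
  rw [Finsupp.mem_support_iff, Basis.piTensorProduct_repr_tprod_apply] at hq₀
  exact hq₀ (Finset.prod_eq_zero (Finset.mem_univ j) (by simpa using h0))

open Classical in
/-- The weight grading of `k⟨P⟩` induced by that of `P`. -/
def HomogeneousPresentation.linearGrading (k : Type w) [CommRing k] {P : SetOperad.{u}}
    (H : HomogeneousPresentation.{u, v} P) : (linearize k P).WeightGrading where
  sub d I _ := Finsupp.supported k k {x : P.obj I | H.weighting.wt x = d}
  isInternal I _ := by
    refine (DirectSum.isInternal_submodule_iff_iSupIndep_and_iSup_eq_top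
      (R := k) (M := P.obj I →₀ k) _).2 ⟨?_, ?_⟩
    · intro d
      have h : ⨆ j, ⨆ (_ : j ≠ d), Finsupp.supported k k {x : P.obj I | H.weighting.wt x = j} ≤
          Finsupp.supported k k {x : P.obj I | H.weighting.wt x ≠ d} :=
        iSup₂_le fun j hj => Finsupp.supported_mono fun x hx h => hj (Eq.trans (Eq.symm hx) h)
      exact (Finsupp.disjoint_supported_supported
        (Set.disjoint_left.2 fun x hx (hx' : _ ≠ d) => hx' hx)).mono_right h
    · rw [← Finsupp.supported_iUnion, Set.eq_univ_of_forall (s := ⋃ i, _) fun x =>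
        Set.mem_iUnion.2 ⟨H.weighting.wt x, rfl⟩, Finsupp.supported_univ]
  sub_zero I _ := by
    have h : {x : P.obj I | H.weighting.wt x = 0} = Set.range fun e : Unit ≃ I => P.map e P.one := by
      ext x
      refine ⟨fun hx => ?_, ?_⟩
      · obtain ⟨e, he⟩ := H.eq_unit_of_wt x hx
        exact ⟨e, he.symm⟩
      · rintro ⟨e, rfl⟩
        exact (H.weighting.wt_map e _).trans H.weighting.wt_one
    refine (Finsupp.supported_eq_span_single k _).trans ?_
    rw [h, ← Set.range_comp]
    refine congrArg (fun s => Submodule.span k (Set.range s)) (funext fun e => ?_)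
    exact (preLinearize_map_single k P e P.one).symm
  map_mem {I J} _ _ e {d x} hx := by
    refine (Finsupp.mem_supported k _).2 fun y hy => ?_
    obtain ⟨x', hx', rfl⟩ := Finset.mem_image.1 (Finsupp.mapDomain_support hy)
    exact (H.weighting.wt_map e x').trans ((Finsupp.mem_supported k _).1 hx hx')
  comp_mem {I J} _ _ f {a b p q} hp hq := by
    refine linComp_mem k P f p q hp hq fun p₀ hp₀ q₀ hq₀ => ?_
    change H.weighting.wt (P.comp f p₀ q₀) = _
    rw [H.weighting.wt_comp, show H.weighting.wt p₀ = a from hp₀, finsum_congr hq₀]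

end OperadPoset

end

noncomputable section

namespace OperadPoset

/-! A chain and a non-degenerate levelled tree with labels in the set operad are the same data. The
underlying partitions of a chain form the shape of a tree. The relation between consecutive elements
says that the blocks of the larger one are composites of the blocks of the smaller one, and the
outer operations of these composites label the vertices of one level. Such operations exist by
definition of the order and are unique because the operad is basic-set (`IsStep.unique`).
Conversely, composing the labels of a tree upwards from the leaves produces a decorated partition at
every height (`LevelShape.composite`).

The conditions on the two sides are matched by the total weight of the blocks, which is a rank
function (`famWt_of_isStep`). A step of weight `0` consists of identities, hence is an equality
(`eq_of_famWt_eq_zero`), so strict inequalities correspond to levels of positive weight. A minimal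
element is the partition into points decorated by identities, and a maximal one is a single block of
weight `d`; hence the weights of the levels add up to `d`. Together, `Chain.tree_injective` and
`Chain.exists_of_labels` give the bijection. Degree `0` needs no separate treatment.

After linearisation, the trees with labels in the set operad form a basis of the full bar
construction. Those coming from chains are part of this basis, and they span the normalised part:
expanding homogeneous labels in the basis of operations preserves the weight of every level
(`span_tree`).

Omitting an inner element of a chain composes two consecutive steps, which is the merging of two
levels, and bijections act compatibly on both sides (`Chain.labels_drop`, `Chain.labels_map`). The
presimplicial identities are elementary for chains, and they pass to the bar construction through
the isomorphism. -/

theorem SetOperad.map_one_congr (P : SetOperad.{u}) {X : Type} [Finite X] (e e' : Unit ≃ X) :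
    P.map e P.one = P.map e' P.one :=
  congrArg (fun t => P.map t P.one) (Equiv.ext fun _ => e.symm.injective (Subsingleton.elim _ _))

/-- The blocks of the partition into points are points. -/
def botFib {I : Type} {σ : Setoid I} (hσ : σ = ⊥) (c : Quotient σ) :
    Unit ≃ Fib (Quotient.mk σ) c where
  toFun _ := ⟨c.out, c.out_eq⟩
  invFun _ := ()
  left_inv _ := rfl
  right_inv x := Subtype.ext <| by
    have h : σ c.out x.1 := Quotient.exact (c.out_eq.trans x.2.symm)
    exact hσ.le h

/-! ### Steps between decorated partitions, and the two extreme kinds of element. -/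

namespace PPart

variable {P : SetOperad.{u}} {I : Type} [Finite I]

/-- The family `ν` exhibits the blocks of `y` as composites of blocks of `x`. -/
def IsStep (x y : PPart P I) (h : x.part ≤ y.part) (ν : P.Fam (qmap h)) : Prop :=
  y.block = P.famComp (Quotient.mk x.part) (qmap h) (Quotient.mk y.part) (fun _ => rfl) ν x.block

theorem IsStep.le {x y : PPart P I} {h : x.part ≤ y.part} {ν : P.Fam (qmap h)}
    (hν : IsStep x y h ν) : x ≤ y := ⟨h, ν, hν⟩

/-- On each block of `y`, both families are composed with the same blocks of `x`, so they can be
cancelled. This is the point where the basic-set hypothesis is applied; later uses of it go through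
this lemma. -/
theorem IsStep.unique (hP : P.IsBasicSet) {x y : PPart P I} {h : x.part ≤ y.part}
    {ν ν' : P.Fam (qmap h)} (hν : IsStep x y h ν) (hν' : IsStep x y h ν') : ν = ν' :=
  funext fun c => hP _ _ (congrFun (hν.symm.trans hν') c)

theorem IsStep.map {I' : Type} [Finite I'] (e : I ≃ I') {x y : PPart P I} {h : x.part ≤ y.part}
    {ν : P.Fam (qmap h)} (hν : IsStep x y h ν) :
    IsStep (x.map e) (y.map e) (comap_le_comap e h)
      (P.famMap (quotEquiv e _) (quotEquiv e _) _ _ (qmap_quotEquiv e h) ν) := by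
  unfold IsStep at hν ⊢
  simp only [PPart.map]
  rw [hν]
  exact (P.famComp_famMap _ _ _ _ _ _ _ _ _ _ _ _ _ _ _ _).symm

/-- Associativity of the composition of families. Naming the composite family explicitly, rather
than only asserting `x ≤ z`, is what lets the omission of an element be compared with the merging of
two levels. -/
theorem IsStep.trans {x y z : PPart P I} {h : x.part ≤ y.part} {h' : y.part ≤ z.part}
    {ν : P.Fam (qmap h)} {ν' : P.Fam (qmap h')} (hν : IsStep x y h ν) (hν' : IsStep y z h' ν') :
    IsStep x z (h.trans h') (P.famComp (qmap h) (qmap h') (qmap (h.trans h'))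
      (fun b => Quotient.inductionOn b fun _ => rfl) ν' ν) := by
  unfold IsStep at *
  rw [hν', hν]
  exact (P.famComp_assoc _ _ _ _ _ _ _ _ _ _ _ _ _).symm

/-- Needed because the elements of a chain after an omission agree with those of the original chain
only up to a propositional equality of indices. -/
theorem IsStep.famCast {x y x' y' : PPart P I} (hx : x = x') (hy : y = y') {h : x.part ≤ y.part}
    (h' : x'.part ≤ y'.part) (hσ : x.part = x'.part) (hτ : y.part = y'.part)
    {ν : P.Fam (qmap h)} (hν : IsStep x y h ν) : IsStep x' y' h' (P.famCast h h' hσ hτ ν) := by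
  subst hx hy
  exact hν

variable (P) in
/-- The partition into points, decorated by identities. -/
def discrete (σ : Setoid I) (hσ : σ = ⊥) : PPart P I where
  part := σ
  block c := P.map (botFib hσ c) P.one

/-- Every operation is its own composite with identities, by the right unit law. The only work is to
relabel the inputs of a block, which are elements of `I`, by the corresponding one-point classes. -/
theorem discrete_le {σ : Setoid I} (hσ : σ = ⊥) (x : PPart P I) : discrete P σ hσ ≤ x := by
  have h : σ ≤ x.part := hσ ▸ bot_le
  let e : ∀ c, Fib (Quotient.mk x.part) c ≃ Fib (qmap h) c := fun c =>
    { toFun := fun i => ⟨Quotient.mk σ i.1, i.2⟩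
      invFun := fun b => ⟨b.1.out, by
        have hb := b.2
        conv_lhs at hb => rw [← b.1.out_eq]
        exact hb⟩
      left_inv := fun i => Subtype.ext <| by
        have h' : σ (Quotient.mk σ i.1).out i.1 := Quotient.mk_out i.1
        exact hσ.le h'
      right_inv := fun b => Subtype.ext b.1.out_eq }
  refine ⟨h, fun c => P.map (e c) (x.block c), ?_⟩
  funext c
  simp only [PreOperad.famComp, discrete]
  -- The right unit law is transported along the square whose sides are the identity on the inputs
  -- of the composite and `e c` on the inputs of the outer operation.
  refine ((P.map_refl _).symm.trans (congrArg _ (P.comp_one (x.block c)).symm)).trans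
    ((P.comp_map (Equiv.refl _) (e c) (fun x => x) _ (fun _ => rfl) (x.block c)
      (P.famOne _)).symm.trans ?_)
  congr 1
  funext b
  refine (P.map_map _ _ _).trans (Eq.trans ?_ (P.map_map _ _ _).symm)
  exact P.map_one_congr _ _

/-- All elements of `I` lie in one block, and its decoration, viewed as an operation with inputs
`I`, is the required `ν`. Without a point of `I` there would be no block to read it from. -/
theorem exists_eq_single [Nonempty I] (x : PPart P I) (hx : x.part = ⊤) :
    ∃ ν, x = single ν := by
  obtain ⟨i₀⟩ := ‹Nonempty I›
  have h : ∀ i, Quotient.mk x.part i = Quotient.mk x.part i₀ := fun i =>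
    Quotient.sound (show x.part i i₀ by rw [hx]; trivial)
  refine ⟨P.map (Equiv.subtypeUnivEquiv h) (x.block _), ext' hx fun i => ?_⟩
  refine ⟨Equiv.subtypeEquivRight fun a => ⟨fun _ => Quotient.sound trivial,
    fun _ => (h a).trans (h i).symm⟩, fun _ => rfl, ?_⟩
  simp only [single, SetOperad.map_map]
  exact P.map_fam x.block (h i) _ _ fun _ _ _ => rfl

end PPart

/-! ### The total weight as a rank function. -/

namespace Weighting

variable {P : SetOperad.{u}} (W : Weighting P.toPreOperad) {I : Type} [Finite I]

/-- The total weight of a family of operations. -/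
def famWt {I J : Type} [Finite I] {f : I → J} (q : P.Fam f) : ℕ := ∑ᶠ j, W.wt (q j)

/-- The fibres of `g` partition `J`, so summing the weights of the inner operations first over each
fibre and then over `K` counts each of them once. -/
theorem famWt_famComp {I J K : Type} [Finite I] [Finite J] [Finite K] (f : I → J) (g : J → K)
    (h : I → K) (hc : ∀ i, g (f i) = h i) (q : P.Fam g) (r : P.Fam f) :
    W.famWt (P.famComp f g h hc q r) = W.famWt q + W.famWt r := by
  have := Fintype.ofFinite J
  have := Fintype.ofFinite K
  have hs : ∀ c, Fintype (Fib g c) := fun c => Fintype.ofFinite _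
  simp only [famWt, PreOperad.famComp, W.wt_comp, W.wt_map, finsum_eq_sum_of_fintype,
    Finset.sum_add_distrib]
  congr 1
  rw [← Fintype.sum_sigma' fun c (b : Fib g c) => W.wt (r b.1)]
  exact Fintype.sum_equiv (Equiv.sigmaFiberEquiv g) _ _ fun _ => rfl

theorem famWt_eq_zero {I J : Type} [Finite I] [Finite J] {f : I → J} {q : P.Fam f}
    (h : W.famWt q = 0) (j : J) : W.wt (q j) = 0 := by
  have := Fintype.ofFinite J
  simp only [famWt, finsum_eq_sum_of_fintype, Finset.sum_eq_zero_iff, Finset.mem_univ,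
    true_implies] at h
  exact h j

theorem famWt_discrete {σ : Setoid I} (hσ : σ = ⊥) :
    W.famWt (PPart.discrete P σ hσ).block = 0 :=
  finsum_eq_zero_of_forall_eq_zero fun _ => (W.wt_map _ _).trans W.wt_one

/-- There is exactly one block. For empty `I` there would be none, and the left side would be `0`
whatever the weight of `ν`. -/
theorem famWt_single [Nonempty I] (ν : P.obj I) : W.famWt (PPart.single ν).block = W.wt ν := by
  have : Unique (Quotient (PPart.single ν).part) :=
    { default := Quotient.mk _ (Classical.arbitrary I)
      uniq := fun c => Quotient.inductionOn c fun _ => Quotient.sound trivial }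
  rw [famWt, finsum_unique]
  exact W.wt_map _ _

variable {W} in
theorem famWt_of_isStep {x y : PPart P I} {h : x.part ≤ y.part} {ν : P.Fam (qmap h)}
    (hν : PPart.IsStep x y h ν) : W.famWt y.block = W.famWt ν + W.famWt x.block :=
  (congrArg W.famWt hν).trans (W.famWt_famComp _ _ _ _ _ _)

theorem ne_of_isStep {x y : PPart P I} {h : x.part ≤ y.part} {ν : P.Fam (qmap h)}
    (hν : PPart.IsStep x y h ν) (h₀ : 0 < W.famWt ν) : x ≠ y := by
  rintro rfl
  have := famWt_of_isStep (W := W) hν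
  omega

theorem famWt_mono {x y : PPart P I} (h : x ≤ y) : W.famWt x.block ≤ W.famWt y.block := by
  obtain ⟨h, ν, hν⟩ := h
  rw [famWt_of_isStep hν]
  omega

end Weighting

/-! ### Rigidity of weight-zero steps; minimal and maximal elements. -/

namespace HomogeneousPresentation

variable {P : SetOperad.{u}} (H : HomogeneousPresentation.{u, v} P) {I : Type} [Finite I]

/-- Weights are natural numbers, so all the operations of the step have weight `0` and are
identities by `eq_unit_of_wt`. An identity has one input, so no blocks are joined, and composing
with it leaves the decorations unchanged. -/
theorem eq_of_famWt_eq_zero {x y : PPart P I} {h : x.part ≤ y.part} {ν : P.Fam (qmap h)}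
    (hν : PPart.IsStep x y h ν) (h₀ : H.weighting.famWt ν = 0) : x = y := by
  have hu : ∀ c, Subsingleton (Fib (qmap h) c) := fun c => by
    obtain ⟨e, -⟩ := H.eq_unit_of_wt (ν c) (Weighting.famWt_eq_zero _ h₀ c)
    exact e.symm.subsingleton
  -- Two elements in one block of `y` define two classes of `x` in the same fibre, which has at most
  -- one element.
  have hp : y.part ≤ x.part := fun a b hab =>
    Quotient.exact (congrArg Subtype.val ((hu (Quotient.mk _ b)).elim
      ⟨Quotient.mk _ a, Quotient.sound hab⟩ ⟨Quotient.mk _ b, rfl⟩))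
  obtain ⟨σ, B⟩ := x
  obtain ⟨τ, C⟩ := y
  obtain rfl : σ = τ := _root_.le_antisymm h hp
  congr 1
  funext c
  obtain ⟨e, he⟩ := H.eq_unit_of_wt (ν c) (Weighting.famWt_eq_zero _ h₀ c)
  -- The unique input of the operation at `c` is the block `c` itself, since the two partitions now
  -- coincide.
  have hc : (e ()).1 = c :=
    (show (e ()).1 = qmap h (e ()).1 from (Quotient.inductionOn (e ()).1 fun _ => rfl)).trans
      (e ()).2
  have hi : ∀ i : Fib (Quotient.mk σ) c,
      fibMap (Quotient.mk σ) (qmap h) (Quotient.mk σ) (fun _ => rfl) c i = e () := fun i =>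
    e.symm.injective (by simp)
  refine Eq.symm ((congrFun hν c).trans ?_)
  simp only [PreOperad.famComp]
  rw [he, P.comp_unit _ e _ (Equiv.subtypeUnivEquiv hi) fun _ => rfl, SetOperad.map_map]
  exact (P.map_fam B hc _ (Equiv.refl _) fun i hi hi' => rfl).trans (P.map_refl _)

theorem eq_of_le_of_famWt_le {x y : PPart P I} (h : x ≤ y)
    (h' : H.weighting.famWt y.block ≤ H.weighting.famWt x.block) : x = y := by
  obtain ⟨h, ν, hν⟩ := h
  have := Weighting.famWt_of_isStep (W := H.weighting) hν
  exact H.eq_of_famWt_eq_zero hν (by omega)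

variable {H} {d : ℕ}

theorem WeightPoset.famWt_le [Nonempty I] (x : H.WeightPoset d I) :
    H.weighting.famWt x.1.block ≤ d := by
  obtain ⟨ν, hν, hx⟩ := x.2
  exact (Weighting.famWt_mono _ hx).trans ((Weighting.famWt_single _ ν).trans hν).le

/-- The decorated partition into points lies below `x`, hence below the same `ν̄` as `x`. It
therefore belongs to the poset, and minimality applies to it. -/
theorem WeightPoset.eq_discrete_of_isMin {x : H.WeightPoset d I} (hx : IsMin x) {σ : Setoid I}
    (hσ : σ = ⊥) : x.1 = PPart.discrete P σ hσ := by
  obtain ⟨ν, hν, hxν⟩ := x.2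
  have h := PPart.discrete_le hσ x.1
  exact H.le_antisymm (hx (b := ⟨_, ν, hν, PPart.le_trans h hxν⟩) h) h

/-- The element `ν̄` that witnesses membership of `x` belongs to the poset by reflexivity, and
maximality forces `x` to be equal to it. -/
theorem WeightPoset.eq_single_of_isMax {x : H.WeightPoset d I} (hx : IsMax x) :
    ∃ ν, H.weighting.wt ν = d ∧ x.1 = PPart.single ν := by
  obtain ⟨ν, hν, hxν⟩ := x.2
  exact ⟨ν, hν, H.le_antisymm hxν (hx (b := ⟨_, ν, hν, PPart.le_refl _⟩) hxν)⟩

/-- The rank is at most `d` throughout the poset, and two comparable elements are equal once the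
larger has no greater rank. -/
theorem WeightPoset.isMax_of_famWt_eq [Nonempty I] {x : H.WeightPoset d I}
    (hx : H.weighting.famWt x.1.block = d) : IsMax x := fun y hxy =>
  (show y = x from Subtype.ext (H.eq_of_le_of_famWt_le hxy (y.famWt_le.trans hx.ge)).symm).le

/-! ### Chains and labelled levelled trees -/

namespace Chain

variable {l : ℕ} (c : H.Chain d I l)

/-- The underlying partitions of a chain. -/
def shape : LevelShape I l where
  part a := (c.elt a).1.part
  mono _ _ h := (c.strictMono.monotone h).1
  part_zero := congrArg PPart.part (WeightPoset.eq_discrete_of_isMin c.isMin rfl)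
  part_last := by
    obtain ⟨ν, -, h⟩ := WeightPoset.eq_single_of_isMax c.isMax
    rw [h]
    rfl

theorem exists_isStep (j : Fin l) : ∃ ν : P.Fam (c.shape.level j),
    PPart.IsStep (c.elt j.castSucc).1 (c.elt j.succ).1
      (c.shape.mono (Fin.castSucc_lt_succ (i := j)).le) ν :=
  (c.strictMono.monotone (Fin.castSucc_lt_succ (i := j)).le).2

/-- The operations relating the consecutive elements of a chain. -/
def labels : P.Labels c.shape := fun j => (c.exists_isStep j).choose

theorem isStep_labels (j : Fin l) :
    PPart.IsStep (c.elt j.castSucc).1 (c.elt j.succ).1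
      (c.shape.mono (Fin.castSucc_lt_succ (i := j)).le) (c.labels j) :=
  (c.exists_isStep j).choose_spec

/-- The labels of a chain are chosen arbitrarily among the witnesses of the order relation.
Uniqueness makes the choice harmless: identifying them reduces to exhibiting steps. -/
theorem labels_eq (hP : P.IsBasicSet) (y : P.Labels c.shape)
    (hy : ∀ j : Fin l, PPart.IsStep (c.elt j.castSucc).1 (c.elt j.succ).1
      (c.shape.mono (Fin.castSucc_lt_succ (i := j)).le) (y j)) : c.labels = y :=
  funext fun j => (c.isStep_labels j).unique hP (hy j)

theorem labels_map (hP : P.IsBasicSet) {J : Type} [Finite J] (e : I ≃ J) :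
    (c.map e).labels = P.mapLabels e c.labels :=
  (c.map e).labels_eq hP _ fun j => (c.isStep_labels j).map e

/-- The step across the omitted element is the composite of the two steps that met there, and all
other steps are unchanged. -/
theorem labels_drop (hP : P.IsBasicSet) (c : H.Chain d I (l + 1)) (i : Fin l) :
    (c.drop i).labels = P.mergeLabels i c.labels := by
  -- The omitted element has index `i + 1`: positions up to `i` keep their index, and later ones
  -- move up by one.
  have hle : ∀ a : Fin (l + 1), (a : ℕ) ≤ i → (c.elt a.castSucc).1 = ((c.drop i).elt a).1 :=
    fun a h => congrArg (fun a => (c.elt a).1)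
      (Fin.succAbove_of_castSucc_lt _ _ (Fin.lt_def.2 (by simpa using by omega))).symm
  have hlt : ∀ a : Fin (l + 1), (i : ℕ) < a → (c.elt a.succ).1 = ((c.drop i).elt a).1 :=
    fun a h => congrArg (fun a => (c.elt a).1)
      (Fin.succAbove_of_le_castSucc _ _ (Fin.le_def.2 (by simpa using by omega))).symm
  refine (c.drop i).labels_eq hP _ fun j => ?_
  rcases lt_trichotomy (j : ℕ) i with h | h | h
  · rw [P.mergeLabels_lt _ h]
    exact (c.isStep_labels j.castSucc).famCast (hle j.castSucc h.le) (hle j.succ h) _ _ _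
  · rw [P.mergeLabels_eq _ h]
    exact ((c.isStep_labels j.castSucc).trans (c.isStep_labels j.succ)).famCast
      (hle j.castSucc h.le) (hlt j.succ (Nat.lt_succ_of_le h.ge)) _ _ _
  · rw [P.mergeLabels_gt _ h]
    exact (c.isStep_labels j.succ).famCast (hlt j.castSucc h)
      (hlt j.succ (h.trans (Nat.lt_succ_self _))) _ _ _

end Chain

end HomogeneousPresentation

/-! ### From labelled trees to sequences of decorated partitions. -/

namespace LevelShape

variable {P : SetOperad.{u}} {I : Type} [Finite I] {l : ℕ} (π : LevelShape I l)
  (y : P.Labels π)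

/-- The composites of the lowest levels of a labelled tree. -/
def composite (a : Fin (l + 1)) : P.Fam (Quotient.mk (π.part a)) :=
  Fin.induction (motive := fun a => P.Fam (Quotient.mk (π.part a)))
    (PPart.discrete P _ π.part_zero).block
    (fun j r => P.famComp (Quotient.mk (π.part j.castSucc)) (π.level j) _ (fun _ => rfl) (y j) r) a

/-- The partition of the leaves by the edges at a given height, decorated by the composites. -/
def ppart (a : Fin (l + 1)) : PPart P I := ⟨π.part a, π.composite y a⟩

theorem ppart_zero : π.ppart y 0 = PPart.discrete P _ π.part_zero := rfl

/-- Holds by definition: the recursion for the composites is exactly the equation of a step. -/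
theorem isStep_ppart (j : Fin l) : PPart.IsStep (π.ppart y j.castSucc) (π.ppart y j.succ)
    (π.mono (Fin.castSucc_lt_succ (i := j)).le) (y j) :=
  rfl

/-- The rank starts at `0` on the partition into points and grows by the weight of each level
crossed. At the last height every level is counted. -/
theorem famWt_ppart (W : Weighting P.toPreOperad) (a : Fin (l + 1)) :
    W.famWt (π.ppart y a).block =
      ∑ j : Fin l, if j.castSucc < a then W.famWt (y j) else 0 := by
  induction a using Fin.induction with
  | zero => simp [ppart_zero, Weighting.famWt_discrete]
  | succ j ih =>
    rw [Weighting.famWt_of_isStep (π.isStep_ppart y j), ih]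
    -- The levels below height `j + 1` are those below height `j`, together with level `j` itself.
    have : ∀ j' : Fin l, (if j'.castSucc < j.succ then W.famWt (y j') else 0) =
        (if j' = j then W.famWt (y j) else 0) +
          if j'.castSucc < j.castSucc then W.famWt (y j') else 0 := fun j' => by
      rcases lt_trichotomy j' j with h | rfl | h
      · simp [h, h.le, h.ne, Fin.castSucc_lt_succ_iff]
      · simp [Fin.castSucc_lt_succ_iff]
      · simp [h.not_gt, h.not_ge, h.ne', Fin.castSucc_lt_succ_iff]
    rw [Finset.sum_congr rfl fun j' _ => this j', Finset.sum_add_distrib,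
      Finset.sum_ite_eq' Finset.univ j]
    simp only [Finset.mem_univ, if_true]
    rfl

end LevelShape

/-! ### The bijection between chains and non-degenerate labelled trees. -/

namespace HomogeneousPresentation

variable {P : SetOperad.{u}} {H : HomogeneousPresentation.{u, v} P} {I : Type} [Finite I] {d l : ℕ}

/-- A chain is recovered from its tree: both sequences start at the minimal element and satisfy the
same recursion. Injectivity of the passage to trees follows. -/
theorem Chain.ppart_labels (c : H.Chain d I l) (a : Fin (l + 1)) :
    c.shape.ppart c.labels a = (c.elt a).1 := by
  suffices h : c.shape.composite c.labels a = (c.elt a).1.block by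
    exact congrArg (PPart.mk (c.elt a).1.part) h
  induction a using Fin.induction with
  | zero =>
    have h := WeightPoset.eq_discrete_of_isMin c.isMin c.shape.part_zero
    -- Decorations of two decorated partitions are comparable only over a common partition; stating
    -- this for an arbitrary `x` makes that partition a variable.
    have h' : ∀ (x : PPart P I) (hx : x.part = ⊥), x = PPart.discrete P x.part hx →
        x.block = (PPart.discrete P x.part hx).block := by
      rintro ⟨σ, B⟩ hx h
      injection h
    exact (h' _ _ h).symm
  | succ j ih =>
    refine Eq.trans ?_ (c.isStep_labels j).symm
    exact congrArg (P.famComp (Quotient.mk (c.shape.part j.castSucc)) (c.shape.level j) _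
      (fun _ => rfl) (c.labels j)) ih

theorem Chain.tree_injective : Function.Injective
    fun c : H.Chain d I l => (⟨c.shape, c.labels⟩ : Σ π : LevelShape I l, P.Labels π) := by
  intro c c' h
  have : c.elt = c'.elt := funext fun a => Subtype.ext <| by
    rw [← c.ppart_labels, ← c'.ppart_labels]
    exact congrArg (fun t : Σ π : LevelShape I l, P.Labels π => t.1.ppart t.2 a) h
  cases c
  cases c'
  congr 1

theorem Chain.famWt_labels_pos (c : H.Chain d I l) (j : Fin l) :
    0 < H.weighting.famWt (c.labels j) := by
  refine Nat.pos_of_ne_zero fun h => ?_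
  exact (c.strictMono (Fin.castSucc_lt_succ (i := j))).ne
    (Subtype.ext (H.eq_of_famWt_eq_zero (c.isStep_labels j) h))

/-- The sum is the rank of the top element, which is a single block of weight `d` by maximality. -/
theorem Chain.sum_famWt_labels [Nonempty I] (c : H.Chain d I l) :
    ∑ j, H.weighting.famWt (c.labels j) = d := by
  obtain ⟨ν, hν, h⟩ := WeightPoset.eq_single_of_isMax c.isMax
  have h' := c.shape.famWt_ppart c.labels H.weighting (Fin.last l)
  rw [c.ppart_labels, h, Weighting.famWt_single, hν] at h'
  simpa [Fin.castSucc_lt_last] using h'.symm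

/-- The chain consists of the partial composites of the tree. The full composite `ν` has weight `d`,
so `ν̄` serves as the upper bound that places all of them in the poset. -/
theorem Chain.exists_of_labels (hP : P.IsBasicSet) [Nonempty I] (π : LevelShape I l)
    (y : P.Labels π) (hpos : ∀ j, 0 < H.weighting.famWt (y j))
    (hsum : ∑ j, H.weighting.famWt (y j) = d) :
    ∃ c : H.Chain d I l,
      (⟨c.shape, c.labels⟩ : Σ π : LevelShape I l, P.Labels π) = ⟨π, y⟩ := by
  have hwt : H.weighting.famWt (π.ppart y (Fin.last l)).block = d := by
    rw [π.famWt_ppart, ← hsum]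
    simp [Fin.castSucc_lt_last]
  obtain ⟨ν, hν⟩ := PPart.exists_eq_single (π.ppart y (Fin.last l)) π.part_last
  have hνd : H.weighting.wt ν = d := by
    rw [← Weighting.famWt_single, ← hν, hwt]
  have hle : ∀ a, π.ppart y a ≤ PPart.single ν := fun a => by
    induction a using Fin.reverseInduction with
    | last => exact hν ▸ PPart.le_refl _
    | cast j ih => exact PPart.le_trans (π.isStep_ppart y j).le ih
  let c : H.Chain d I l :=
    { elt := fun a => ⟨π.ppart y a, ν, hνd, hle a⟩
      -- A level of positive weight strictly raises the rank, so its two ends differ.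
      strictMono := Fin.strictMono_iff_lt_succ.2 fun j =>
        lt_of_le_of_ne (π.isStep_ppart y j).le fun h =>
          H.weighting.ne_of_isStep (π.isStep_ppart y j) (hpos j) (congrArg Subtype.val h)
      isMin := fun x _ => PPart.discrete_le π.part_zero x.1
      isMax := WeightPoset.isMax_of_famWt_eq hwt }
  exact ⟨c, congrArg (Sigma.mk π) (c.labels_eq hP y fun j => π.isStep_ppart y j)⟩

end HomogeneousPresentation

theorem DFinsupp_basis_repr_apply {ι : Type*} {R : Type*} {M : ι → Type*} {η : ι → Type*} [Semiring R]
    [∀ i, AddCommMonoid (M i)] [∀ i, Module R (M i)] (b : ∀ i, Module.Basis (η i) R (M i))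
    (x : Π₀ i, M i) (i : ι) (q : η i) : (DFinsupp.basis b).repr x ⟨i, q⟩ = (b i).repr (x i) q :=
  rfl

/-! ### Evaluation of the face maps. -/

theorem innerFaces_last {X : Type*} [Zero X] {l : ℕ} (d : Fin l → X) :
    innerFaces d (Fin.last (l + 1)) = 0 := by
  rw [← Fin.succ_last, innerFaces, Fin.cases_succ, Fin.lastCases_last]

theorem innerFaces_inner {X : Type*} [Zero X] {l : ℕ} (d : Fin l → X) (i : Fin l) :
    innerFaces d i.castSucc.succ = d i := by
  rw [innerFaces, Fin.cases_succ, Fin.lastCases_castSucc]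

section OrderComplex

variable (k : Type w) [CommRing k] {P : SetOperad.{u}} (H : HomogeneousPresentation.{u, v} P)
  (d l : ℕ) (I : Type) [Finite I] [Nonempty I]

theorem orderComplex_face_zero : (orderComplex k H d).face l I 0 = 0 := rfl

theorem orderComplex_face_last : (orderComplex k H d).face l I (Fin.last _) = 0 :=
  innerFaces_last _

theorem orderComplex_face_inner (i : Fin l) : (orderComplex k H d).face l I i.castSucc.succ =
    Finsupp.lmapDomain k k fun c : H.Chain d I (l + 1) => c.drop i :=
  innerFaces_inner _ i

end OrderComplex

section NormalisedBar

variable {k : Type u} [CommRing k] {P : LinOperad.{u, v} k} (G : P.WeightGrading) (d l : ℕ)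
  (I : Type) [Finite I] [Nonempty I]

theorem normalisedBar_face_last : (G.normalisedBar d).face l I (Fin.last _) = 0 :=
  innerFaces_last _

theorem normalisedBar_face_inner (i : Fin l) : (G.normalisedBar d).face l I i.castSucc.succ =
    (P.barMerge i).restrict (G.barMerge_mem d i) :=
  innerFaces_inner _ i

end NormalisedBar

/-! ### A basis of the bar construction of the linearised operad. -/

section Linearize

variable (k : Type w) [CommRing k] {P : SetOperad.{u}} {I : Type} [Finite I] {l : ℕ}

/-- A levelled tree labelled by operations of `P`, as a tree labelled by basis elements. -/
def singleLabels {π : LevelShape I l} (y : P.Labels π) : (linearize k P).Labels π :=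
  fun j b => (Finsupp.single (y j b) 1 : P.obj _ →₀ k)

theorem mapLabels_single {J : Type} [Finite J] (e : I ≃ J) {π : LevelShape I l} (y : P.Labels π) :
    (linearize k P).mapLabels e (singleLabels k y) = singleLabels k (P.mapLabels e y) :=
  funext fun j => preLinearize_famMap_single k P _ _ _ _ _ (y j)

theorem famCast_single {σ τ σ' τ' : Setoid I} (h : σ ≤ τ) (h' : σ' ≤ τ') (hσ : σ = σ')
    (hτ : τ = τ') (q : P.Fam (qmap h)) :
    (preLinearize k P).famCast h h' hσ hτ (fun b => Finsupp.single (q b) 1) =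
      fun b => Finsupp.single (P.famCast h h' hσ hτ q b) 1 := by
  subst hσ hτ
  rfl

/-- Composites of basis operations are basis operations, so merging levels carries trees with labels
in the set operad to trees of the same kind. -/
theorem mergeLabels_single {π : LevelShape I (l + 1)} (i : Fin l) (y : P.Labels π) :
    (linearize k P).mergeLabels i (singleLabels k y) = singleLabels k (P.mergeLabels i y) := by
  funext j
  rcases lt_trichotomy (j : ℕ) i with h | h | h
  · refine (PreOperad.mergeLabels_lt _ _ h).trans ((famCast_single k _ _ _ _ _).trans ?_)
    rw [← PreOperad.mergeLabels_lt _ y h]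
    rfl
  · refine (PreOperad.mergeLabels_eq _ _ h).trans
      ((congrArg _ (preLinearize_famComp_single k P _ _ _ _ _ _)).trans
        ((famCast_single k _ _ _ _ _).trans ?_))
    rw [← PreOperad.mergeLabels_eq _ y h]
    rfl
  · refine (PreOperad.mergeLabels_gt _ _ h).trans ((famCast_single k _ _ _ _ _).trans ?_)
    rw [← PreOperad.mergeLabels_gt _ y h]
    rfl

/-- The basis of the module of trees of a given shape given by the labels in `P`. -/
def treeTensorBasis (π : LevelShape I l) : Module.Basis (∀ v : π.Vertex, P.obj (π.In v)) k
    ((linearize k P).TreeTensor π) :=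
  Basis.piTensorProduct fun v : π.Vertex =>
    (Finsupp.basisSingleOne : Module.Basis (P.obj (π.In v)) k (P.obj (π.In v) →₀ k))

variable (P l I) in
/-- The basis of the bar construction of `k⟨P⟩` given by the trees labelled by operations of `P`. -/
def barBasis : Module.Basis (Σ π : LevelShape I l, ∀ v : π.Vertex, P.obj (π.In v)) k
    ((linearize k P).Bar l I) :=
  DFinsupp.basis fun π => treeTensorBasis k π

/-- This is the multilinear expansion of a tree: the coefficient of a basis labelling is the product
of the coefficients at the vertices. -/
theorem barBasis_repr_tree [∀ π : LevelShape I l, Fintype π.Vertex] (π : LevelShape I l)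
    (y : (linearize k P).Labels π)
    (q : ∀ v : π.Vertex, P.obj (π.In v)) :
    (barBasis k P I l).repr ((linearize k P).tree π y) ⟨π, q⟩ =
      ∏ v : π.Vertex, (show P.obj (π.In v) →₀ k from y v.1 v.2) (q v) := by
  classical
  refine (DFinsupp_basis_repr_apply (fun π => treeTensorBasis k π) _ π q).trans ?_
  refine (congrArg (fun t => (treeTensorBasis k π).repr t q) (DirectSum.of_eq_same π _)).trans ?_
  exact Basis.piTensorProduct_repr_tprod_apply _ _ q

theorem barBasis_repr_tree_of_ne {π π' : LevelShape I l} (h : π' ≠ π)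
    (y : (linearize k P).Labels π)
    (q : ∀ v : π'.Vertex, P.obj (π'.In v)) :
    (barBasis k P I l).repr ((linearize k P).tree π y) ⟨π', q⟩ = 0 := by
  classical
  refine (DFinsupp_basis_repr_apply (fun π => treeTensorBasis k π) _ π' q).trans ?_
  refine (congrArg (fun t => (treeTensorBasis k π').repr t q)
    (DirectSum.of_eq_of_ne π π' _ h)).trans ?_
  exact congrArg (fun f => f q) (map_zero (treeTensorBasis k π').repr)

theorem barBasis_apply (π : LevelShape I l) (y : P.Labels π) :
    barBasis k P I l ⟨π, fun v => y v.1 v.2⟩ = (linearize k P).tree π (singleLabels k y) := by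
  classical
  have := fun π : LevelShape I l => Fintype.ofFinite π.Vertex
  refine (barBasis k P I l).repr.injective (Finsupp.ext fun ⟨π', q⟩ => ?_)
  rw [Module.Basis.repr_self]
  by_cases h : π' = π
  · subst h
    rw [barBasis_repr_tree, Finsupp.single_apply]
    refine Eq.trans ?_ (Finset.prod_congr rfl fun v _ => (Finsupp.single_apply (a := y v.1 v.2)
      (a' := q v) (b := (1 : k))).symm)
    -- A product of Kronecker deltas over the vertices is the Kronecker delta of the whole
    -- labelling.
    rw [Fintype.prod_ite_zero, Finset.prod_const_one]
    simp only [Sigma.mk.injEq, heq_eq_eq, true_and, funext_iff]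
  · rw [barBasis_repr_tree_of_ne k h, Finsupp.single_eq_of_ne fun h' => h (congrArg Sigma.fst h')]

end Linearize

/-! ### The isomorphism, and its compatibility with bijections and faces. -/

section Iso

variable (k : Type w) [CommRing k] {P : SetOperad.{u}} {H : HomogeneousPresentation.{u, v} P}
  {I : Type} [Finite I] {d l : ℕ}

/-- The labelled tree of a chain. -/
def HomogeneousPresentation.Chain.tree (c : H.Chain d I l) : (linearize k P).Bar l I :=
  (linearize k P).tree c.shape (singleLabels k c.labels)

/-- Distinct chains have distinct labelled trees, so these vectors are distinct members of a basis.
-/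
theorem linearIndependent_tree :
    LinearIndependent k fun c : H.Chain d I l => c.tree k := by
  have h := (barBasis k P I l).linearIndependent.comp
    (fun c : H.Chain d I l => ⟨c.shape, fun v => c.labels v.1 v.2⟩) fun c c' h => by
      refine HomogeneousPresentation.Chain.tree_injective ?_
      exact congrArg (fun t : Σ π : LevelShape I l, ∀ v : π.Vertex, P.obj (π.In v) =>
        (⟨t.1, fun j b => t.2 ⟨j, b⟩⟩ : Σ π : LevelShape I l, P.Labels π)) h
  convert h using 2 with c
  exact (barBasis_apply k c.shape c.labels).symm

/-- The normalised part is generated by trees whose labels are arbitrary homogeneous elements.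
Expanding such a tree in the basis yields only labellings with the same weight at each vertex, hence
with positive level weights of sum `d`; these come from chains. -/
theorem span_tree [Nonempty I] (hP : P.IsBasicSet) :
    Submodule.span k (Set.range fun c : H.Chain d I l => c.tree k) =
      (H.linearGrading k).normalised d l I := by
  have := fun π : LevelShape I l => Fintype.ofFinite π.Vertex
  refine le_antisymm (Submodule.span_le.2 ?_) (Submodule.span_le.2 ?_)
  · rintro _ ⟨c, rfl⟩
    refine Submodule.subset_span ⟨_, _, fun j => H.weighting.famWt (c.labels j),
      c.famWt_labels_pos, c.sum_famWt_labels, fun j => ⟨fun b => H.weighting.wt (c.labels j b),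
        fun b => ?_, rfl⟩, rfl⟩
    exact Finsupp.single_mem_supported k _ rfl
  · rintro _ ⟨π, y, a, ha, hd, hy, rfl⟩
    choose b hb hba using hy
    have h : (linearize k P).tree π y ∈ Submodule.span k (barBasis k P I l ''
        {t | ∃ c : H.Chain d I l, t = ⟨c.shape, fun v => c.labels v.1 v.2⟩}) := by
      rw [Module.Basis.mem_span_image]
      rintro ⟨π', q⟩ hq
      rw [Finset.mem_coe, Finsupp.mem_support_iff] at hq
      by_cases hπ : π' = π
      · subst hπ
        rw [barBasis_repr_tree] at hq
        -- The coordinate at `q` is a non-zero product, so each `q ⟨j, c⟩` is in the support of the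
        -- label there, which is homogeneous of weight `b j c`.
        have hw : ∀ j c, H.weighting.wt (q ⟨j, c⟩) = b j c := fun j c =>
          (Finsupp.mem_supported k _).1 (hb j c) (Finsupp.mem_support_iff.2 fun h0 =>
            hq (Finset.prod_eq_zero (Finset.mem_univ ⟨j, c⟩) h0))
        have hf : ∀ j, H.weighting.famWt (fun c => q ⟨j, c⟩ : P.Fam (π'.level j)) = a j :=
          fun j => (finsum_congr (hw j)).trans (hba j)
        obtain ⟨c, hc⟩ := HomogeneousPresentation.Chain.exists_of_labels (H := H) (d := d) hP π'
          (fun j c => q ⟨j, c⟩) (fun j => (hf j).symm ▸ ha j)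
          ((Finset.sum_congr rfl fun j _ => hf j).trans hd)
        exact ⟨c, congrArg (fun t : Σ π : LevelShape I l, P.Labels π =>
          (⟨t.1, fun v => t.2 v.1 v.2⟩ :
            Σ π : LevelShape I l, ∀ v : π.Vertex, P.obj (π.In v))) hc.symm⟩
      · exact absurd (barBasis_repr_tree_of_ne k hπ y q) hq
    refine Submodule.span_mono ?_ h
    rintro _ ⟨_, ⟨c, rfl⟩, rfl⟩
    exact ⟨c, (barBasis_apply k c.shape c.labels).symm⟩

variable (H d) in
/-- The isomorphism sending a chain to its labelled tree. -/
def treeEquiv [Nonempty I] (hP : P.IsBasicSet) :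
    (H.Chain d I l →₀ k) ≃ₗ[k] (H.linearGrading k).normalised d l I :=
  (linearIndependent_tree k).linearCombinationEquiv.trans (LinearEquiv.ofEq _ _ (span_tree k hP))

theorem treeEquiv_single [Nonempty I] (hP : P.IsBasicSet) (c : H.Chain d I l) :
    (treeEquiv k H d hP (Finsupp.single c 1) : (linearize k P).Bar l I) = c.tree k := by
  simp [treeEquiv]

theorem barMap_tree_chain (hP : P.IsBasicSet) {J : Type} [Finite J] (e : I ≃ J)
    (c : H.Chain d I l) : (linearize k P).barMap e (c.tree k) = (c.map e).tree k := by
  unfold HomogeneousPresentation.Chain.tree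
  rw [LinOperad.barMap_tree, mapLabels_single, c.labels_map hP e]
  rfl

theorem barMerge_tree_chain (hP : P.IsBasicSet) (c : H.Chain d I (l + 1)) (i : Fin l) :
    (linearize k P).barMerge i (c.tree k) = (c.drop i).tree k := by
  unfold HomogeneousPresentation.Chain.tree
  rw [LinOperad.barMerge_tree, mergeLabels_single, c.labels_drop hP i]
  rfl

variable (H d) in
/-- The isomorphism between the order complex and the normalised bar construction. -/
def orderComplexIso (hP : P.IsBasicSet) :
    PresimplicialIso (orderComplex k H d) ((H.linearGrading k).normalisedBar d) where
  toEquiv _ _ _ _ := treeEquiv k H d hP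
  map_act l I J _ _ _ _ e x := by
    -- Both sides are linear, so it is enough to compare them on a single chain.
    refine lin_ext k ((treeEquiv k H d hP).toLinearMap.comp
        (Finsupp.lmapDomain k k fun c : H.Chain d I l => c.map e))
      ((((H.linearGrading k).normalisedBar d).act l e).comp (treeEquiv k H d hP).toLinearMap)
      (fun c => Subtype.ext ?_) x
    refine Eq.trans ?_ (congrArg ((linearize k P).barMap e) (treeEquiv_single k hP c)).symm
    rw [barMap_tree_chain k hP]
    refine Eq.trans ?_ (treeEquiv_single k hP (c.map e))
    exact congrArg (fun t => (treeEquiv k H d hP t).1) Finsupp.mapDomain_single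
  map_face l I _ _ i x := by
    induction i using Fin.cases with
    -- The outer faces vanish on both sides; only the inner ones carry content.
    | zero => exact map_zero (treeEquiv k H d hP)
    | succ i =>
      induction i using Fin.lastCases with
      | last =>
        rw [Fin.succ_last, orderComplex_face_last, normalisedBar_face_last]
        exact map_zero (treeEquiv k H d hP)
      | cast i =>
        rw [orderComplex_face_inner, normalisedBar_face_inner]
        let F : (H.linearGrading k).normalised d (l + 1) I →ₗ[k]
            (H.linearGrading k).normalised d l I :=
          ((linearize k P).barMerge i).restrict ((H.linearGrading k).barMerge_mem d i)
        refine lin_ext (N := (H.linearGrading k).normalised d l I) k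
          ((treeEquiv k H d hP).toLinearMap.comp
            (Finsupp.lmapDomain k k fun c : H.Chain d I (l + 1) => c.drop i))
          (F.comp (treeEquiv k H d hP).toLinearMap)
          (fun c => Subtype.ext ?_) x
        refine Eq.trans ?_ (congrArg ((linearize k P).barMerge i) (treeEquiv_single k hP c)).symm
        rw [barMerge_tree_chain k hP]
        refine Eq.trans ?_ (treeEquiv_single k hP (c.drop i))
        exact congrArg (fun t => (treeEquiv k H d hP t).1) Finsupp.mapDomain_single

end Iso

/-! ### The presimplicial identities. -/

theorem HomogeneousPresentation.Chain.ext_elt {P : SetOperad.{u}}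
    {H : HomogeneousPresentation.{u, v} P} {I : Type} [Finite I] {d l : ℕ} {c c' : H.Chain d I l}
    (h : c.elt = c'.elt) : c = c' := by
  cases c
  cases c'
  congr 1

theorem orderComplex_isPresimplicialSModule (k : Type w) [CommRing k] {P : SetOperad.{u}}
    (H : HomogeneousPresentation.{u, v} P) (d : ℕ) :
    (orderComplex k H d).IsPresimplicialSModule where
  act_refl l I _ _ x := by
    refine (congrArg (fun f => Finsupp.mapDomain f x) (funext fun c => ?_)).trans
      Finsupp.mapDomain_id
    exact HomogeneousPresentation.Chain.ext_elt (funext fun a => Subtype.ext (PPart.map_refl _))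
  act_trans l I J K _ _ _ _ _ _ e e' x := by
    refine (congrArg (fun f => Finsupp.mapDomain f x) (funext fun c => ?_)).trans
      Finsupp.mapDomain_comp
    exact HomogeneousPresentation.Chain.ext_elt
      (funext fun a => Subtype.ext (PPart.map_map _ _ _).symm)
  face_act l I J _ _ _ _ e i x := by
    induction i using Fin.cases with
    | zero => exact (map_zero ((orderComplex k H d).act l e)).symm
    | succ i =>
      induction i using Fin.lastCases with
      | last =>
        simp only [Fin.succ_last, orderComplex_face_last]
        exact (map_zero ((orderComplex k H d).act l e)).symm
      | cast i =>
        rw [orderComplex_face_inner, orderComplex_face_inner]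
        exact (Finsupp.mapDomain_comp (f := fun c : H.Chain d I (l + 1) => c.map e)
          (g := fun c => c.drop i) (v := x)).symm.trans
          (Finsupp.mapDomain_comp (f := fun c : H.Chain d I (l + 1) => c.drop i)
            (g := fun c => c.map e))
  face_face l I _ _ i j hij x := by
    induction i using Fin.cases with
    | zero =>
      rw [Fin.castSucc_zero, orderComplex_face_zero, orderComplex_face_zero]
      exact (map_zero ((orderComplex k H d).face l I j)).symm
    | succ i =>
      induction j using Fin.cases with
      | zero => simp at hij
      | succ j =>
        induction j using Fin.lastCases with
        | last =>
          rw [Fin.succ_last, Fin.succ_last, orderComplex_face_last, orderComplex_face_last]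
          exact map_zero ((orderComplex k H d).face l I i.succ)
        | cast j =>
          induction i using Fin.lastCases with
          | last => exact absurd hij (by simp [Fin.le_def])
          | cast i =>
            have hij' : i ≤ j := by simpa using hij
            -- All four indices are brought to the form `_.castSucc.succ`, in which inner faces are
            -- evaluated.
            rw [← Fin.succ_castSucc i.castSucc,
              show j.castSucc.succ.succ = j.succ.castSucc.succ from rfl, orderComplex_face_inner,
              orderComplex_face_inner, orderComplex_face_inner, orderComplex_face_inner]
            refine (Finsupp.mapDomain_comp (f := fun c : H.Chain d I (l + 2) => c.drop j.succ)
              (g := fun c => c.drop i) (v := x)).symm.trans (Eq.trans ?_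
              (Finsupp.mapDomain_comp (f := fun c : H.Chain d I (l + 2) => c.drop i.castSucc)
                (g := fun c => c.drop j)))
            refine congrArg (fun f => Finsupp.mapDomain f x) (funext fun c => ?_)
            -- Both sides omit the elements of index `i + 1` and `j + 2` of the original chain.
            -- Since `i ≤ j`, omitting the lower one first shifts the index of the other to `j + 1`.
            refine HomogeneousPresentation.Chain.ext_elt (funext fun a => congrArg c.elt ?_)
            refine Fin.ext ?_
            have := Fin.le_def.1 hij'
            simp only [Fin.succAbove, Fin.lt_def]
            split_ifs <;> simp at * <;> omega

/-- Each identity in `N` is the image of the same identity in `M`. This spares a direct verification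
for trees, where repeated merging would involve associativity of composition and transport between
equal partitions. -/
theorem PresimplicialIso.isPresimplicialSModule {k : Type u} [CommRing k]
    {M : PresimplicialData.{u, v} k} {N : PresimplicialData.{u, w} k} (φ : PresimplicialIso M N)
    (hM : M.IsPresimplicialSModule) : N.IsPresimplicialSModule where
  act_refl l I _ _ x := by
    obtain ⟨x, rfl⟩ := (φ.toEquiv l I).surjective x
    rw [← φ.map_act, hM.act_refl]
  act_trans l I J K _ _ _ _ _ _ e e' x := by
    obtain ⟨x, rfl⟩ := (φ.toEquiv l I).surjective x
    simp only [← φ.map_act, hM.act_trans]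
  face_act l I J _ _ _ _ e i x := by
    obtain ⟨x, rfl⟩ := (φ.toEquiv (l + 1) I).surjective x
    simp only [← φ.map_act, ← φ.map_face, hM.face_act]
  face_face l I _ _ i j hij x := by
    obtain ⟨x, rfl⟩ := (φ.toEquiv (l + 2) I).surjective x
    simp only [← φ.map_face, hM.face_face l I i j hij]

end OperadPoset

end

theorem mainTheorem9 (k : Type w) [CommRing k] (P : OperadPoset.SetOperad.{u})
    (hP : P.IsBasicSet)
    (hP₀ : ∀ (I : Type) [Finite I] [IsEmpty I], IsEmpty (P.obj I))
    (H : OperadPoset.HomogeneousPresentation.{u, v} P) (d : ℕ) :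
    (OperadPoset.orderComplex k H d).IsPresimplicialSModule ∧
      ((H.linearGrading k).normalisedBar d).IsPresimplicialSModule ∧
      Nonempty (OperadPoset.PresimplicialIso (OperadPoset.orderComplex k H d)
        ((H.linearGrading k).normalisedBar d)) :=
  ⟨OperadPoset.orderComplex_isPresimplicialSModule k H d,
    (OperadPoset.orderComplexIso k H d hP).isPresimplicialSModule
      (OperadPoset.orderComplex_isPresimplicialSModule k H d),
    ⟨OperadPoset.orderComplexIso k H d hP⟩⟩
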